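/- Let $k\ge 1$ be an integer, let $\beta\in(0,1]$ and let $0\le\alpha_1<\dots<\alpha_k<1$ be fixed reals. Let $\delta(n),\eta_1(n),\dots,\eta_k(n)$ be real sequences tending to $0$ as $n\to\infty$, and for each $n$ put \[ L_n=[-1,\,-\beta+\delta(n)]\cup\{\alpha_1+\eta_1(n),\dots,\alpha_k+\eta_k(n)\}. \] For $L\subseteq\mathbb{R}$, a spherical $L$-code in $\mathbb{R}^n$ is a finite non-empty set $C$ of unit vectors in $\mathbb{R}^n$ such that $\langle x,y\rangle\in L$ for any two distinct $x,y\in C$. Then there is a function $r(n)=o(n^k)$, depending only on $k$, $\beta$, the $\alpha_i$ and the sequences $\delta,\eta_1,\dots,\eta_k$, such that for all sufficiently large $n$ every spherical $L_n$-code $C$ in $\mathbb{R}^n$ satisfies \[ |C|\le\Bigl(1+\frac{\alpha_1}{\beta}\Bigr)(k-1)!\,(2n)^k+r(n). \] -/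

import Mathlib

open Filter Topology Asymptotics

/-- A spherical `L`-code in `ℝⁿ`: a finite non-empty set of unit vectors such that the inner product
of any two distinct ones lies in `L`. (Usually `L ⊆ [-1, 1)`; values outside `[-1, 1)` are never
inner products of distinct unit vectors, so nothing has to be asked of `L` here.) -/
def IsSphericalCode {n : ℕ} (L : Set ℝ) (C : Finset (EuclideanSpace ℝ (Fin n))) : Prop :=
  C.Nonempty ∧ (∀ x ∈ C, ‖x‖ = 1) ∧ ∀ x ∈ C, ∀ y ∈ C, x ≠ y → inner ℝ x y ∈ L

/-! The proof is by induction on the number k of nonnegative values. Bounds are stated for all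
parameters near the limiting ones, so that they survive projection and perturbation.

Projection is the main tool. Vectors having a common projection of squared norm ρ on a line become,
after projecting it out and normalizing, a code with values (α_i - ρ)/(1 - ρ). Values below ρ turn
negative and merge into the negative range, so fewer values remain.

If the smallest value is 0 and m others remain, subtract that value from every entry of the Gram
matrix. The rank is at most n + 1, so |C|²(1 - a)² ≤ (n + 1) times the squared Frobenius norm
(`card_mul_le_of_symm_factor`). The vectors at value α_j from a fixed x are projected off x; the
value 0 turns negative, and induction gives at most about (m - 1)! (2n)^m / α_j of them
(`SharpBound.degree`). The negative entries of a row have square sum at most about Σ α_j D_j, where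
D_j bounds these degrees (`sq_sum_inner_le_of_degree`). A row thus contributes at most about Σ (α_j²
+ α_j) D_j ≤ m! 2^(m+1) n^m, giving m! (2n)^(m+1).

If the smallest value α is positive, remove large cliques of that value one after another. An
outside vector sees almost all of a clique at one level (`IsCode.majority`). Those seeing it at
level α project to a code with smallest value 0, giving the main term; those at a larger value lose
α under projection and number O(n^m). Those seeing it negatively are kept. More than N = ⌊α/β⌋ + 1
mutually repelling cliques would give a vector of negative squared norm (`card_le_of_blocks`), so
the main term is paid at most N ≤ 1 + α/β times. What is left has no large clique of value α and has
size O(n^m) (`exists_evBound_of_free`). -/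

namespace SphericalCode

open scoped Classical

/-! ### Combinatorial preliminaries: Ramsey and averaging -/

/-- Finite multicolour Ramsey theorem. -/
theorem exists_monochromatic {C : Type} [Fintype C] (t : C → ℕ) :
    ∃ R : ℕ, 0 < R ∧ ∀ {ι : Type} (S : Finset ι) (f : ι → ι → C), (∀ x y, f x y = f y x) →
      R ≤ S.card → ∃ c, ∃ Y ⊆ S, Y.card = t c ∧ ∀ x ∈ Y, ∀ y ∈ Y, x ≠ y → f x y = c := by
  induction hs : ∑ c, t c generalizing t with
  | zero =>
    refine ⟨1, one_pos, fun {ι} S f _ hR => ?_⟩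
    obtain ⟨x, hx⟩ := Finset.card_pos.1 hR
    refine ⟨f x x, ∅, by simp, ?_, by simp⟩
    have := (Finset.sum_eq_zero_iff.1 hs) (f x x) (Finset.mem_univ _)
    simp [this]
  | succ s ih =>
    by_cases h0 : ∃ c, t c = 0
    · obtain ⟨c, hc⟩ := h0
      exact ⟨1, one_pos, fun {ι} S f _ _ => ⟨c, ∅, by simp, by simp [hc], by simp⟩⟩
    · push Not at h0
      have key : ∀ c, ∑ d, Function.update t c (t c - 1) d = s := by
        intro c
        have h1 := Finset.sum_update_of_mem (Finset.mem_univ c) t (t c - 1)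
        have h2 := Finset.add_sum_erase Finset.univ t (Finset.mem_univ c)
        rw [Finset.sdiff_singleton_eq_erase] at h1
        have := h0 c
        omega
      choose R hR0 hR using fun c => ih _ (key c)
      refine ⟨1 + ∑ c, R c, by omega, fun {ι} S f hf hS => ?_⟩
      obtain ⟨a, ha⟩ := Finset.card_pos.1 (by omega : 0 < S.card)
      have hcard : ∑ c, R c ≤ ∑ c, ((S.erase a).filter (fun y => f a y = c)).card := by
        rw [← Finset.card_eq_sum_card_fiberwise (f := fun y => f a y) (fun _ _ => by simp),
          Finset.card_erase_of_mem ha]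
        omega
      obtain ⟨c, -, hc⟩ := Finset.exists_le_of_sum_le ⟨f a a, Finset.mem_univ _⟩ hcard
      have hsub : ∀ Y ⊆ (S.erase a).filter (fun y => f a y = c), Y ⊆ S := fun Y hY y hy =>
        Finset.mem_of_mem_erase (Finset.mem_filter.1 (hY hy)).1
      obtain ⟨c', Y, hY, hYc, hYm⟩ := hR c _ f hf hc
      by_cases hcc : c' = c
      · subst hcc
        have haY : a ∉ Y := fun h => by simpa using (Finset.mem_filter.1 (hY h)).1
        refine ⟨c', insert a Y, Finset.insert_subset ha (hsub Y hY), ?_, ?_⟩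
        · rw [Finset.card_insert_of_notMem haY, hYc, Function.update_self]
          have := h0 c'
          omega
        · have ha' : ∀ y ∈ Y, f a y = c' := fun y hy => (Finset.mem_filter.1 (hY hy)).2
          intro y hy z hz hne
          rcases Finset.mem_insert.1 hy with h1 | h1 <;> rcases Finset.mem_insert.1 hz with h2 | h2
          · exact absurd (h1.trans h2.symm) hne
          · rw [h1]; exact ha' z h2
          · rw [hf, h2]; exact ha' y h1
          · exact hYm y h1 z h2 hne
      · refine ⟨c', Y, hsub Y hY, ?_, hYm⟩
        rw [hYc, Function.update_of_ne hcc]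

/-- If each `x ∈ X` has at most `r` exceptional elements in `Y`, then some subset of `Y` of size
`t` has no exceptional element for most `x ∈ X`. -/
theorem exists_subset_card_of_few_exceptions {ι ι' : Type} (Y : Finset ι) (X : Finset ι')
    (P : ι' → ι → Prop) (r B t : ℕ) (hB : 0 < B) (hY : Y.card = B * t)
    (hr : ∀ x ∈ X, (Y.filter (fun y => P x y)).card ≤ r) :
    ∃ Y' ⊆ Y, Y'.card = t ∧
      ((B : ℝ) - r) * X.card ≤ B * (X.filter (fun x => ∀ y ∈ Y', ¬ P x y)).card := by
  -- Cut `Y` into `B` blocks of size `t`. The at most `r` exceptions of a given `x` spoil at most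
  -- `r` blocks, so double counting yields one block that is clean for a fraction at least (B - r)/B
  -- of `X`.
  let e : Fin B × Fin t ≃ Y := finProdFinEquiv.trans (Y.equivFinOfCardEq hY).symm
  let blk : Fin B → Finset ι := fun b => Finset.univ.image (fun s : Fin t => (e (b, s) : ι))
  have hblk : ∀ b, blk b ⊆ Y := by
    intro b y hy
    obtain ⟨s, -, rfl⟩ := Finset.mem_image.1 hy
    exact (e (b, s)).2
  have hcard : ∀ b, (blk b).card = t := by
    intro b
    rw [Finset.card_image_of_injective, Finset.card_univ, Fintype.card_fin]
    intro s s' h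
    have := e.injective (Subtype.ext h)
    simpa using this
  have hbad : ∀ x ∈ X, ((Finset.univ : Finset (Fin B)).filter
      (fun b => ¬ ∀ y ∈ blk b, ¬ P x y)).card ≤ r := by
    intro x hx
    refine le_trans ?_ (hr x hx)
    have hch : ∀ b : Fin B, (¬ ∀ y ∈ blk b, ¬ P x y) → ∃ s, P x (e (b, s)) := by
      intro b hb
      push Not at hb
      obtain ⟨y, hy, hP⟩ := hb
      obtain ⟨s, -, rfl⟩ := Finset.mem_image.1 hy
      exact ⟨s, hP⟩
    rcases isEmpty_or_nonempty (Fin t) with hemp | hne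
    · rw [Finset.filter_false_of_mem]
      · simp
      · exact fun b _ hb => hemp.elim (hch b hb).choose
    choose! s hs using hch
    refine Finset.card_le_card_of_injOn (fun b => (e (b, s b) : ι)) ?_ ?_
    · intro b hb
      have hb := (Finset.mem_filter.1 (Finset.mem_coe.1 hb)).2
      exact Finset.mem_coe.2 (Finset.mem_filter.2 ⟨(e _).2, hs b hb⟩)
    · intro b _ b' _ h
      have := e.injective (Subtype.ext h)
      exact (Prod.ext_iff.1 this).1
  have hgood : ∀ x ∈ X, (B : ℝ) - r ≤ ((Finset.univ : Finset (Fin B)).filter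
      (fun b => ∀ y ∈ blk b, ¬ P x y)).card := by
    intro x hx
    have h1 := Finset.card_filter_add_card_filter_not (s := (Finset.univ : Finset (Fin B)))
      (fun b => ∀ y ∈ blk b, ¬ P x y)
    have h2 := hbad x hx
    rw [Finset.card_univ, Fintype.card_fin] at h1
    have h3 : (B : ℝ) ≤ ((Finset.univ : Finset (Fin B)).filter
      (fun b => ∀ y ∈ blk b, ¬ P x y)).card + r := by exact_mod_cast (by omega)
    linarith
  have hdc : ∑ x ∈ X, ((Finset.univ : Finset (Fin B)).filter (fun b => ∀ y ∈ blk b, ¬ P x y)).card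
      = ∑ b : Fin B, (X.filter (fun x => ∀ y ∈ blk b, ¬ P x y)).card := by
    simp only [Finset.card_filter]
    exact Finset.sum_comm
  have hsum : ∑ _b : Fin B, ((B : ℝ) - r) * X.card / B ≤
      ∑ b : Fin B, ((X.filter (fun x => ∀ y ∈ blk b, ¬ P x y)).card : ℝ) := by
    have h1 : ((B : ℝ) - r) * X.card ≤ ∑ x ∈ X, (((Finset.univ : Finset (Fin B)).filter
        (fun b => ∀ y ∈ blk b, ¬ P x y)).card : ℝ) := by
      have := Finset.sum_le_sum hgood
      rw [Finset.sum_const, nsmul_eq_mul] at this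
      linarith
    have h2 : (B : ℝ) ≠ 0 := by positivity
    rw [Finset.sum_const, nsmul_eq_mul, Finset.card_univ, Fintype.card_fin, mul_div_cancel₀ _ h2]
    refine h1.trans (le_of_eq ?_)
    exact_mod_cast hdc
  obtain ⟨b, -, hb⟩ := Finset.exists_le_of_sum_le ⟨⟨0, hB⟩, Finset.mem_univ _⟩ hsum
  refine ⟨blk b, hblk b, hcard b, ?_⟩
  rw [div_le_iff₀ (by positivity)] at hb
  linarith

/-! ### Equiangular families and mutually repelling vectors -/

/-- A family of unit vectors any two of which have inner product `c`. -/
structure IsEquiangular {ι : Type} {n : ℕ} (c : ℝ) (v : ι → EuclideanSpace ℝ (Fin n))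
    (Y : Finset ι) : Prop where
  unit : ∀ x ∈ Y, inner ℝ (v x) (v x) = 1
  pair : ∀ x ∈ Y, ∀ y ∈ Y, x ≠ y → inner ℝ (v x) (v y) = c

theorem IsEquiangular.mono {ι : Type} {n : ℕ} {c : ℝ} {v : ι → EuclideanSpace ℝ (Fin n)}
    {Y Y' : Finset ι} (h : IsEquiangular c v Y) (hY : Y' ⊆ Y) : IsEquiangular c v Y' :=
  ⟨fun x hx => h.unit x (hY hx), fun x hx y hy => h.pair x (hY hx) y (hY hy)⟩

theorem inner_sum_smul_sum_smul {ι : Type} {n : ℕ} (c d : ι → ℝ)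
    (v : ι → EuclideanSpace ℝ (Fin n)) (S T : Finset ι) :
    inner ℝ (∑ x ∈ S, c x • v x) (∑ y ∈ T, d y • v y) =
      ∑ x ∈ S, ∑ y ∈ T, c x * d y * inner ℝ (v x) (v y) := by
  rw [sum_inner]
  refine Finset.sum_congr rfl fun x _ => ?_
  rw [inner_sum]
  refine Finset.sum_congr rfl fun y _ => ?_
  rw [real_inner_smul_left, real_inner_smul_right, mul_assoc]

theorem IsEquiangular.inner_sum_smul {ι : Type} {n : ℕ} {a : ℝ}
    {v : ι → EuclideanSpace ℝ (Fin n)} {Y : Finset ι} (h : IsEquiangular a v Y) (c : ι → ℝ) :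
    inner ℝ (∑ x ∈ Y, c x • v x) (∑ y ∈ Y, c y • v y) =
      (1 - a) * ∑ x ∈ Y, c x ^ 2 + a * (∑ x ∈ Y, c x) ^ 2 := by
  rw [inner_sum_smul_sum_smul]
  have : ∀ x ∈ Y, ∑ y ∈ Y, c x * c y * inner ℝ (v x) (v y) =
      (1 - a) * c x ^ 2 + a * (c x * ∑ y ∈ Y, c y) := by
    intro x hx
    have h1 : ∀ y ∈ Y, c x * c y * inner ℝ (v x) (v y) =
        a * (c x * c y) + if x = y then (1 - a) * c x ^ 2 else 0 := by
      intro y hy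
      split_ifs with hxy
      · subst hxy; rw [h.unit x hx]; ring
      · rw [h.pair x hx y hy hxy]; ring
    rw [Finset.sum_congr rfl h1, Finset.sum_add_distrib, Finset.sum_ite_eq, if_pos hx,
      ← Finset.mul_sum, ← Finset.mul_sum]
    ring
  rw [Finset.sum_congr rfl this, Finset.sum_add_distrib, ← Finset.mul_sum, ← Finset.mul_sum,
    ← Finset.sum_mul]
  ring

theorem IsEquiangular.inner_sum_self {ι : Type} {n : ℕ} {a : ℝ}
    {v : ι → EuclideanSpace ℝ (Fin n)} {Y : Finset ι} (h : IsEquiangular a v Y) :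
    inner ℝ (∑ x ∈ Y, v x) (∑ y ∈ Y, v y) = (1 - a) * Y.card + a * (Y.card : ℝ) ^ 2 := by
  have := h.inner_sum_smul (fun _ => 1)
  simpa using this

theorem abs_inner_le_one_of_unit {n : ℕ} {x y : EuclideanSpace ℝ (Fin n)}
    (hx : inner ℝ x x = 1) (hy : inner ℝ y y = 1) : |inner ℝ x y| ≤ 1 := by
  have := abs_real_inner_le_norm x y
  rw [real_inner_self_eq_norm_sq] at hx hy
  have h1 : ‖x‖ = 1 := by nlinarith [norm_nonneg x]
  have h2 : ‖y‖ = 1 := by nlinarith [norm_nonneg y]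
  rw [h1, h2] at this
  linarith

/-- A unit vector cannot see two large disjoint parts of an equiangular family at levels
separated by `g`. -/
theorem IsEquiangular.card_le_of_separated {ι : Type} {n : ℕ} {a : ℝ}
    {v : ι → EuclideanSpace ℝ (Fin n)} {Y : Finset ι} (h : IsEquiangular a v Y) (ha : -1 ≤ a)
    {u : EuclideanSpace ℝ (Fin n)} (hu : inner ℝ u u = 1) {P Q : Finset ι} (hP : P ⊆ Y)
    (hQ : Q ⊆ Y) {q : ℕ} (hPc : q ≤ P.card) (hQc : q ≤ Q.card) {s g : ℝ} (hg : 0 < g)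
    (hPs : ∀ y ∈ P, s + g ≤ inner ℝ u (v y)) (hQs : ∀ y ∈ Q, inner ℝ u (v y) ≤ s) :
    (q : ℝ) * g ^ 2 ≤ 4 := by
  obtain ⟨P', hP', rfl⟩ := Finset.exists_subset_card_eq hPc
  obtain ⟨Q', hQ', hc⟩ := Finset.exists_subset_card_eq hQc
  have hdisj : Disjoint P' Q' := by
    rw [Finset.disjoint_left]
    intro y h1 h2
    have := hPs y (hP' h1)
    have := hQs y (hQ' h2)
    linarith
  -- Test `u` against the sum over `P'` minus the sum over `Q'`. The coefficients cancel, so the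
  -- squared norm is only 2(1 - a) times the common size of `P'` and `Q'`, while the inner product
  -- with `u` is at least `g` times that size.
  let c : ι → ℝ := fun y => if y ∈ P' then 1 else -1
  have hE := (h.mono (Finset.union_subset (hP'.trans hP) (hQ'.trans hQ))).inner_sum_smul c
  have hcP : ∀ y ∈ P', c y = 1 := fun y hy => if_pos hy
  have hcQ : ∀ y ∈ Q', c y = -1 := fun y hy =>
    if_neg fun h => Finset.disjoint_left.1 hdisj h hy
  have hs2 : ∑ x ∈ P' ∪ Q', c x ^ 2 = 2 * P'.card := by
    have h1 : ∑ x ∈ P', c x ^ 2 = ∑ x ∈ P', 1 :=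
      Finset.sum_congr rfl fun y hy => by rw [hcP y hy, one_pow]
    have h2 : ∑ x ∈ Q', c x ^ 2 = ∑ x ∈ Q', 1 :=
      Finset.sum_congr rfl fun y hy => by rw [hcQ y hy]; norm_num
    rw [Finset.sum_union hdisj, h1, h2]
    simp [hc]; ring
  have hs1 : ∑ x ∈ P' ∪ Q', c x = 0 := by
    rw [Finset.sum_union hdisj, Finset.sum_congr rfl hcP, Finset.sum_congr rfl hcQ]
    simp [hc]
  set z := ∑ x ∈ P' ∪ Q', c x • v x with hz
  rw [hs2, hs1] at hE
  have hlow : (P'.card : ℝ) * g ≤ inner ℝ u z := by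
    rw [hz, inner_sum, Finset.sum_union hdisj]
    simp only [inner_smul_right]
    have h1 : P'.card • (s + g) ≤ ∑ x ∈ P', c x * inner ℝ u (v x) :=
      Finset.card_nsmul_le_sum _ _ _ fun y hy => by rw [hcP y hy, one_mul]; exact hPs y (hP' hy)
    have h2 : Q'.card • (-s) ≤ ∑ x ∈ Q', c x * inner ℝ u (v x) :=
      Finset.card_nsmul_le_sum _ _ _ fun y hy => by
        rw [hcQ y hy]; linarith [hQs y (hQ' hy)]
    rw [nsmul_eq_mul] at h1 h2
    rw [hc] at h2
    linarith
  have hcs := real_inner_mul_inner_self_le u z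
  rw [hu, hE] at hcs
  have hq : (0 : ℝ) ≤ P'.card := by positivity
  have h3 : ((P'.card : ℝ) * g) ^ 2 ≤ 4 * P'.card := by
    have : ((P'.card : ℝ) * g) ^ 2 ≤ inner ℝ u z ^ 2 := by gcongr
    nlinarith
  rcases hq.eq_or_lt with h0 | h0
  · rw [← h0]; norm_num
  · have : (P'.card : ℝ) * (P'.card * g ^ 2) ≤ P'.card * 4 := by nlinarith
    exact le_of_mul_le_mul_left this h0

/-- Unit vectors with pairwise inner products at most `-g`. -/
theorem card_le_of_inner_le_neg {ι : Type} {n : ℕ} {v : ι → EuclideanSpace ℝ (Fin n)}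
    {S : Finset ι} {g d : ℝ} (hg : 0 < g) (hd : 0 ≤ d) (hunit : ∀ x ∈ S, inner ℝ (v x) (v x) ≤ d)
    (hpair : ∀ x ∈ S, ∀ y ∈ S, x ≠ y → inner ℝ (v x) (v y) ≤ -g) :
    (S.card : ℝ) ≤ 1 + d / g := by
  have h0 : 0 ≤ inner ℝ (∑ x ∈ S, v x) (∑ x ∈ S, v x) := real_inner_self_nonneg
  have h1 : inner ℝ (∑ x ∈ S, v x) (∑ x ∈ S, v x) ≤ ∑ x ∈ S, (d + g - S.card * g) := by
    rw [sum_inner]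
    refine Finset.sum_le_sum fun x hx => ?_
    rw [inner_sum, ← Finset.add_sum_erase _ _ hx]
    have h2 : ∑ y ∈ S.erase x, inner ℝ (v x) (v y) ≤ (S.erase x).card • (-g) :=
      Finset.sum_le_card_nsmul _ _ _ fun y hy =>
        hpair x hx y (Finset.mem_of_mem_erase hy) (Finset.ne_of_mem_erase hy).symm
    rw [Finset.card_erase_of_mem hx, nsmul_eq_mul,
      Nat.cast_sub (Finset.card_pos.2 ⟨x, hx⟩)] at h2
    have := hunit x hx
    push_cast at h2
    linarith
  rw [Finset.sum_const, nsmul_eq_mul] at h1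
  rcases S.eq_empty_or_nonempty with rfl | hne
  · simp; positivity
  · have hpos : (0 : ℝ) < S.card := by exact_mod_cast Finset.card_pos.2 hne
    have h3 : 0 ≤ d + g - S.card * g := by
      by_contra hcon
      push Not at hcon
      nlinarith
    have : (S.card : ℝ) * g ≤ d + g := by linarith
    have h4 : (S.card : ℝ) ≤ (d + g) / g := by rwa [le_div_iff₀ hg]
    rw [add_div, div_self hg.ne'] at h4
    linarith

/-- Successive extraction of blocks of vectors that are pairwise far apart. -/
theorem card_le_of_blocks {ι : Type} {n : ℕ} {v : ι → EuclideanSpace ℝ (Fin n)}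
    {S : Finset ι} {A γ M R : ℝ} {T N : ℕ} (hT : 0 < T) (hγ : A < N * γ) (hM : 0 ≤ M)
    (hstep : ∀ S' ⊆ S, R < S'.card → ∃ Y ⊆ S', Y.card = T ∧
      inner ℝ (∑ y ∈ Y, v y) (∑ y ∈ Y, v y) ≤ A * (T : ℝ) ^ 2 ∧
      ((S'.filter (fun x => -(T * γ) < inner ℝ (v x) (∑ y ∈ Y, v y))).card : ℝ) ≤ M) :
    (S.card : ℝ) ≤ N * M + R := by
  by_contra hcon
  push Not at hcon
  -- `z` is the sum of `r` extracted blocks: `r` diagonal terms of size at most A T² and r(r - 1)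
  -- cross terms of size at most -γ T². Survivors are needed only for r ≤ N, so the last block costs
  -- nothing: N + 1 blocks for N losses. At r = N + 1 the bound is (N + 1)(A - Nγ)T² < 0.
  have key : ∀ r : ℕ, r ≤ N + 1 → ∃ z : EuclideanSpace ℝ (Fin n),
      inner ℝ z z ≤ (T : ℝ) ^ 2 * (r * A - r * (r - 1) * γ) ∧
      (r ≤ N → ∃ S' ⊆ S, (S.card : ℝ) ≤ S'.card + r * M ∧
        ∀ x ∈ S', inner ℝ (v x) z ≤ -(r * T * γ)) := by
    intro r
    induction r with
    | zero => exact fun _ => ⟨0, by simp, fun _ => ⟨S, le_rfl, by simp, by simp⟩⟩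
    | succ r ih =>
      intro hr
      obtain ⟨z, hz, hS⟩ := ih (by omega)
      obtain ⟨S', hS', hcard, hin⟩ := hS (by omega)
      have hrN : (r : ℝ) ≤ N := by exact_mod_cast (by omega : r ≤ N)
      obtain ⟨Y, hY, hYT, hYA, hYM⟩ := hstep S' hS' (by nlinarith)
      refine ⟨z + ∑ y ∈ Y, v y, ?_, fun _ => ⟨S'.filter (fun x =>
        ¬ (-(T * γ) < inner ℝ (v x) (∑ y ∈ Y, v y))), ?_, ?_, ?_⟩⟩
      · rw [inner_add_left, inner_add_right, inner_add_right,
          real_inner_comm (∑ y ∈ Y, v y) z]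
        have : inner ℝ (∑ y ∈ Y, v y) z ≤ T * (-(r * T * γ)) := by
          rw [sum_inner]
          have := Finset.sum_le_card_nsmul Y (fun y => inner ℝ (v y) z) _
            (fun y hy => hin y (hY hy))
          rwa [nsmul_eq_mul, hYT] at this
        push_cast
        linarith
      · exact (Finset.filter_subset _ _).trans hS'
      · have h1 := Finset.card_filter_add_card_filter_not (s := S')
          (fun x => -(T * γ) < inner ℝ (v x) (∑ y ∈ Y, v y))
        have h2 := congrArg (Nat.cast (R := ℝ)) h1
        push_cast at h2 ⊢
        linarith
      · intro x hx
        obtain ⟨hx, hx'⟩ := Finset.mem_filter.1 hx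
        have := hin x hx
        rw [inner_add_right]
        push_cast
        linarith
  obtain ⟨z, hz, -⟩ := key (N + 1) le_rfl
  have h0 : 0 ≤ inner ℝ z z := real_inner_self_nonneg
  have hTp : (0 : ℝ) < (T : ℝ) ^ 2 := by positivity
  have h1 : 0 ≤ ((N + 1 : ℕ) : ℝ) * A - ((N + 1 : ℕ) : ℝ) * (((N + 1 : ℕ) : ℝ) - 1) * γ := by
    by_contra hc
    push Not at hc
    nlinarith
  push_cast at h1
  have : (0 : ℝ) < N + 1 := by positivity
  nlinarith

/-! ### Projection and the rank inequality -/

/-- Orthogonal projection off `w` of vectors with the same component along `w`. -/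
theorem exists_projection {ι : Type} {n : ℕ} {v : ι → EuclideanSpace ℝ (Fin n)}
    {S : Finset ι} {w : EuclideanSpace ℝ (Fin n)} {c r : ℝ} (hw : w ≠ 0)
    (hc : ∀ x ∈ S, inner ℝ (v x) w = c) (hr : c ^ 2 = r * inner ℝ w w) :
    ∃ v' : ι → EuclideanSpace ℝ (Fin n), ∀ x ∈ S, ∀ y ∈ S,
      inner ℝ (v' x) (v' y) = inner ℝ (v x) (v y) - r := by
  have hw' : inner ℝ w w ≠ 0 := inner_self_ne_zero.2 hw
  refine ⟨fun x => v x - (c / inner ℝ w w) • w, fun x hx y hy => ?_⟩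
  rw [inner_sub_left, inner_sub_right, inner_sub_right, real_inner_smul_left,
    real_inner_smul_left, real_inner_smul_right, real_inner_smul_right, hc x hx,
    real_inner_comm (v y) w, hc y hy]
  have hr' : r = c ^ 2 / inner ℝ w w := by rw [hr]; field_simp
  rw [hr']
  field_simp
  ring

theorem exists_normalized_projection {ι : Type} {n : ℕ} {v : ι → EuclideanSpace ℝ (Fin n)}
    {S : Finset ι} {w : EuclideanSpace ℝ (Fin n)} {c r : ℝ} (hw : w ≠ 0)
    (hc : ∀ x ∈ S, inner ℝ (v x) w = c) (hr : c ^ 2 = r * inner ℝ w w) (hr1 : r < 1) :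
    ∃ v' : ι → EuclideanSpace ℝ (Fin n), ∀ x ∈ S, ∀ y ∈ S,
      inner ℝ (v' x) (v' y) = (inner ℝ (v x) (v y) - r) / (1 - r) := by
  obtain ⟨v', hv'⟩ := exists_projection hw hc hr
  have hs : 0 < 1 - r := by linarith
  refine ⟨fun x => (Real.sqrt (1 - r))⁻¹ • v' x, fun x hx y hy => ?_⟩
  rw [real_inner_smul_left, real_inner_smul_right, hv' x hx y hy, ← mul_assoc, ← mul_inv,
    Real.mul_self_sqrt hs.le, div_eq_inv_mul]

/-- Cauchy–Schwarz on the nonzero eigenvalues: there are rank-many of them, their sum is the trace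
and their square sum is the squared Frobenius norm. The factorization bounds the rank. -/
theorem card_mul_le_of_symm_factor {ι m : Type} [Fintype ι] [Fintype m]
    (A : Matrix ι m ℝ) (B : Matrix m ι ℝ) (hsymm : (A * B).IsHermitian) :
    ((A * B).trace) ^ 2 ≤ Fintype.card m * ∑ x, ∑ y, (A * B) x y ^ 2 := by
  set M := A * B with hM
  have hrank : M.rank ≤ Fintype.card m := (Matrix.rank_mul_le_left A B).trans A.rank_le_card_width
  have htr : M.trace = ∑ i, hsymm.eigenvalues i := by
    simpa using hsymm.trace_eq_sum_eigenvalues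
  have htr2 : ∑ x, ∑ y, M x y ^ 2 = ∑ i, hsymm.eigenvalues i ^ 2 := by
    have h1 : (M * M).trace = ∑ x, ∑ y, M x y ^ 2 := by
      simp only [Matrix.trace, Matrix.diag, Matrix.mul_apply]
      refine Finset.sum_congr rfl fun x _ => Finset.sum_congr rfl fun y _ => ?_
      have := hsymm.apply x y
      simp at this
      rw [this]; ring
    rw [← h1]
    conv_lhs => rw [hsymm.spectral_theorem, ← map_mul, Unitary.conjStarAlgAut_apply,
      Matrix.trace_mul_comm, ← mul_assoc]
    simp [Matrix.trace, sq]
  rw [htr, htr2]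
  have h2 : ∑ i, hsymm.eigenvalues i =
      ∑ i ∈ Finset.univ.filter (fun i => hsymm.eigenvalues i ≠ 0), hsymm.eigenvalues i := by
    rw [Finset.sum_filter_ne_zero]
  rw [h2]
  refine (sq_sum_le_card_mul_sum_sq).trans ?_
  have h3 : ((Finset.univ.filter (fun i => hsymm.eigenvalues i ≠ 0)).card : ℝ) ≤ Fintype.card m := by
    have := hsymm.rank_eq_card_non_zero_eigs
    rw [Fintype.card_subtype] at this
    exact_mod_cast this ▸ hrank
  refine mul_le_mul h3 ?_ (Finset.sum_nonneg fun i _ => sq_nonneg _) (by positivity)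
  exact Finset.sum_le_sum_of_subset_of_nonneg (Finset.filter_subset _ _) fun i _ _ => sq_nonneg _

/-! ### Codes and their large cliques -/

/-- A family of unit vectors whose pairwise inner products are at most `-b` or one of the values
`a j`, `j ∈ J`. -/
structure IsCode {ι κ : Type} {n : ℕ} (b : ℝ) (J : Finset κ) (a : κ → ℝ)
    (v : ι → EuclideanSpace ℝ (Fin n)) (S : Finset ι) : Prop where
  unit : ∀ x ∈ S, inner ℝ (v x) (v x) = 1
  pair : ∀ x ∈ S, ∀ y ∈ S, x ≠ y → inner ℝ (v x) (v y) ≤ -b ∨ ∃ j ∈ J, inner ℝ (v x) (v y) = a j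

section
variable {ι κ : Type} {n : ℕ} {b : ℝ} {J : Finset κ} {a : κ → ℝ}
  {v : ι → EuclideanSpace ℝ (Fin n)} {S : Finset ι}

theorem IsCode.mono {S' : Finset ι} (h : IsCode b J a v S) (hS : S' ⊆ S) : IsCode b J a v S' :=
  ⟨fun x hx => h.unit x (hS hx), fun x hx y hy => h.pair x (hS hx) y (hS hy)⟩

/-- Since q g² > 4, `IsEquiangular.card_le_of_separated` forbids two levels with `q` members each.
There are |J| + 1 levels, so by pigeonhole one has at least `q` members and every other one fewer
than `q`. -/
theorem IsCode.majority (h : IsCode b J a v S) {c : ℝ} {Y : Finset ι} (hYS : Y ⊆ S)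
    (hY : IsEquiangular c v Y) (hc : -1 ≤ c) {x : ι} (hx : x ∈ S) (hxY : x ∉ Y) {g : ℝ}
    (hg : 0 < g) (hsep : ∀ j ∈ J, ∀ j' ∈ J, j ≠ j' → g ≤ |a j - a j'|)
    (hneg : ∀ j ∈ J, g ≤ a j + b) {q : ℕ} (hq : 4 < q * g ^ 2)
    (hT : (J.card + 1) * q ≤ Y.card) :
    (Y.filter (fun y => ¬ inner ℝ (v x) (v y) ≤ -b)).card ≤ J.card * q ∨
      ∃ j ∈ J, (Y.filter (fun y => inner ℝ (v x) (v y) ≠ a j)).card ≤ J.card * q := by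
  have hu := h.unit x hx
  set P : κ → Finset ι := fun j => Y.filter (fun y => inner ℝ (v x) (v y) = a j) with hP
  set P0 := Y.filter (fun y => inner ℝ (v x) (v y) ≤ -b) with hP0
  have hcase : ∀ y ∈ Y, y ∈ P0 ∨ ∃ j ∈ J, y ∈ P j := by
    intro y hy
    rcases h.pair x hx y (hYS hy) (fun e => hxY (e ▸ hy)) with h1 | ⟨j, hj, h1⟩
    · exact Or.inl (Finset.mem_filter.2 ⟨hy, h1⟩)
    · exact Or.inr ⟨j, hj, Finset.mem_filter.2 ⟨hy, h1⟩⟩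
  have hno0 : ∀ j ∈ J, q ≤ P0.card → (P j).card ≤ q - 1 := by
    intro j hj h0
    by_contra hcon
    have := hY.card_le_of_separated hc hu (P := P j) (Q := P0) (Finset.filter_subset _ _)
      (Finset.filter_subset _ _) (q := q) (by omega) h0 (s := -b) hg
      (fun y hy => by
        have := hneg j hj
        rw [(Finset.mem_filter.1 hy).2]; linarith)
      (fun y hy => (Finset.mem_filter.1 hy).2)
    linarith
  have hno : ∀ j ∈ J, ∀ j' ∈ J, j ≠ j' → q ≤ (P j).card → (P j').card ≤ q - 1 := by
    have aux : ∀ j ∈ J, ∀ j' ∈ J, g ≤ a j - a j' → q ≤ (P j).card → q ≤ (P j').card → False := by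
      intro j hj j' hj' hd h1 h2
      have := hY.card_le_of_separated hc hu (P := P j) (Q := P j') (Finset.filter_subset _ _)
        (Finset.filter_subset _ _) (q := q) h1 h2 (s := a j') hg
        (fun y hy => by rw [(Finset.mem_filter.1 hy).2]; linarith)
        (fun y hy => (Finset.mem_filter.1 hy).2.le)
      linarith
    intro j hj j' hj' hne h1
    by_contra hcon
    have h2 : q ≤ (P j').card := by omega
    rcases le_abs.1 (hsep j hj j' hj' hne) with h3 | h3
    · exact aux j hj j' hj' h3 h1 h2
    · exact aux j' hj' j hj (by linarith) h2 h1
  by_cases h0 : q ≤ P0.card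
  · left
    refine (Finset.card_le_card (t := J.biUnion P) ?_).trans
      (Finset.card_biUnion_le_card_mul _ _ _ fun j hj => (hno0 j hj h0).trans (Nat.sub_le _ _))
    intro y hy
    obtain ⟨hy, hy'⟩ := Finset.mem_filter.1 hy
    rcases hcase y hy with h1 | ⟨j, hj, h1⟩
    · exact absurd (Finset.mem_filter.1 h1).2 hy'
    · exact Finset.mem_biUnion.2 ⟨j, hj, h1⟩
  · right
    by_cases hj : ∃ j ∈ J, q ≤ (P j).card
    · obtain ⟨j, hj, hqj⟩ := hj
      refine ⟨j, hj, (Finset.card_le_card (t := P0 ∪ (J.erase j).biUnion P) ?_).trans ?_⟩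
      · intro y hy
        obtain ⟨hy, hy'⟩ := Finset.mem_filter.1 hy
        rcases hcase y hy with h1 | ⟨j', hj', h1⟩
        · exact Finset.mem_union_left _ h1
        · refine Finset.mem_union_right _ (Finset.mem_biUnion.2 ⟨j', ?_, h1⟩)
          refine Finset.mem_erase.2 ⟨?_, hj'⟩
          rintro rfl
          exact hy' (Finset.mem_filter.1 h1).2
      · have h1 : ((J.erase j).biUnion P).card ≤ (J.erase j).card * q :=
          Finset.card_biUnion_le_card_mul _ _ _ fun j' hj' =>
            (hno j hj j' (Finset.mem_of_mem_erase hj') (Finset.ne_of_mem_erase hj').symm hqj).trans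
              (Nat.sub_le _ _)
        have h2 := Finset.card_union_le P0 ((J.erase j).biUnion P)
        have h3 := Finset.card_erase_add_one hj
        have h4 : J.card * q = (J.erase j).card * q + q := by rw [← h3]; ring
        omega
    · exfalso
      push Not at hj
      have h1 : (J.biUnion P).card ≤ J.card * q :=
        Finset.card_biUnion_le_card_mul _ _ _ fun j' hj' => (hj j' hj').le
      have h2 : Y.card ≤ (P0 ∪ J.biUnion P).card := by
        refine Finset.card_le_card fun y hy => ?_
        rcases hcase y hy with h1 | ⟨j', hj', h1⟩
        · exact Finset.mem_union_left _ h1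
        · exact Finset.mem_union_right _ (Finset.mem_biUnion.2 ⟨j', hj', h1⟩)
      have h3 := Finset.card_union_le P0 (J.biUnion P)
      have h4 : (J.card + 1) * q = J.card * q + q := by ring
      omega

/-- By `IsCode.majority`, a vector outside `Y` that sees it mostly negatively fails the filter
condition: the at most |J| q exceptions contribute at most 1 each, which `hγ` allows for. Every
other one sees most of `Y` at a single `a j`; passing to a clean block of size `t` makes this exact
at the cost of the factor B/(B - |J| q). -/
theorem IsCode.card_filter_le_of_block (h : IsCode b J a v S) (hb : 0 ≤ b) {c : ℝ}
    {S' Y : Finset ι} (hS' : S' ⊆ S) (hYS : Y ⊆ S')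
    (hY : IsEquiangular c v Y) (hc : -1 ≤ c) {g : ℝ}
    (hg : 0 < g) (hsep : ∀ j ∈ J, ∀ j' ∈ J, j ≠ j' → g ≤ |a j - a j'|)
    (hneg : ∀ j ∈ J, g ≤ a j + b) {q B t : ℕ} (hq : 4 < q * g ^ 2)
    (hB : (J.card + 1) * q < B) (ht : 0 < t) (hYc : Y.card = B * t) {γ : ℝ}
    (hγ : (B * t : ℝ) * γ ≤ b * (B * t - J.card * q) - J.card * q) (F : κ → ℝ)
    (hF : ∀ j ∈ J, ∀ X ⊆ S', ∀ Y' ⊆ Y, Y'.card = t →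
      (∀ x ∈ X, ∀ y ∈ Y', inner ℝ (v x) (v y) = a j) → (X.card : ℝ) ≤ F j) :
    ((S'.filter (fun x => -((B * t : ℝ) * γ) < inner ℝ (v x) (∑ y ∈ Y, v y))).card : ℝ) ≤
      B * t + ∑ j ∈ J, (B : ℝ) / (B - J.card * q) * F j := by
  set X : κ → Finset ι := fun j => S'.filter (fun x =>
    (Y.filter (fun y => inner ℝ (v x) (v y) ≠ a j)).card ≤ J.card * q) with hX
  have hT : (J.card + 1) * q ≤ Y.card := by
    rw [hYc]
    calc _ ≤ B := hB.le
      _ ≤ B * t := Nat.le_mul_of_pos_right _ ht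
  have hrB : (J.card : ℝ) * q < B := by
    have : J.card * q < B := by
      have : (J.card + 1) * q = J.card * q + q := by ring
      omega
    exact_mod_cast this
  have hBpos : 0 < B := by omega
  have hsub : S'.filter (fun x => -((B * t : ℝ) * γ) < inner ℝ (v x) (∑ y ∈ Y, v y)) ⊆
      Y ∪ J.biUnion X := by
    intro x hx
    obtain ⟨hxS, hx⟩ := Finset.mem_filter.1 hx
    by_cases hxY : x ∈ Y
    · exact Finset.mem_union_left _ hxY
    refine Finset.mem_union_right _ ?_
    rcases h.majority (hYS.trans hS') hY hc (hS' hxS) hxY hg hsep hneg hq hT with h1 | ⟨j, hj, h1⟩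
    · exfalso
      rw [inner_sum, ← Finset.sum_filter_add_sum_filter_not Y
        (fun y => ¬ inner ℝ (v x) (v y) ≤ -b)] at hx
      set P := Y.filter (fun y => ¬ inner ℝ (v x) (v y) ≤ -b) with hP
      set Q := Y.filter (fun y => ¬ ¬ inner ℝ (v x) (v y) ≤ -b) with hQ
      have hPQ : P.card + Q.card = Y.card := Finset.card_filter_add_card_filter_not _
      have h2 : ∑ y ∈ P, inner ℝ (v x) (v y) ≤ P.card • (1 : ℝ) :=
        Finset.sum_le_card_nsmul _ _ _ fun y hy =>
          (abs_le.1 (abs_inner_le_one_of_unit (h.unit x (hS' hxS))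
            (hY.unit y (Finset.mem_filter.1 hy).1))).2
      have h3 : ∑ y ∈ Q, inner ℝ (v x) (v y) ≤ Q.card • (-b) :=
        Finset.sum_le_card_nsmul _ _ _ fun y hy => not_not.1 (Finset.mem_filter.1 hy).2
      rw [nsmul_eq_mul] at h2 h3
      have h4 : (P.card : ℝ) ≤ J.card * q := by exact_mod_cast h1
      have h5 : (P.card : ℝ) + Q.card = B * t := by exact_mod_cast hPQ.trans hYc
      have h6 : (Q.card : ℝ) = B * t - P.card := by linarith
      rw [h6] at h3
      nlinarith
    · exact Finset.mem_biUnion.2 ⟨j, hj, Finset.mem_filter.2 ⟨hxS, h1⟩⟩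
  have hXj : ∀ j ∈ J, ((X j).card : ℝ) ≤ (B : ℝ) / (B - J.card * q) * F j := by
    intro j hj
    obtain ⟨Y', hY', hY'c, hle⟩ := exists_subset_card_of_few_exceptions Y (X j)
      (fun x y => inner ℝ (v x) (v y) ≠ a j) (J.card * q) B t hBpos hYc
      (fun x hx => le_of_eq_of_le (by congr) (Finset.mem_filter.1 hx).2)
    have h1 := hF j hj ((X j).filter (fun x => ∀ y ∈ Y', ¬ inner ℝ (v x) (v y) ≠ a j))
      ((Finset.filter_subset _ _).trans (Finset.filter_subset _ _)) Y' hY' hY'c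
      (fun x hx y hy => not_not.1 ((Finset.mem_filter.1 hx).2 y hy))
    rw [div_mul_eq_mul_div, le_div_iff₀ (by linarith)]
    push_cast at hle
    have : (B : ℝ) * ((X j).filter (fun x => ∀ y ∈ Y', ¬ inner ℝ (v x) (v y) ≠ a j)).card ≤
        B * F j := by gcongr
    rw [mul_comm]
    refine (hle.trans (le_of_eq ?_)).trans this
    congr
  have h1 : ((Y ∪ J.biUnion X).card : ℝ) ≤ B * t + ∑ j ∈ J, ((X j).card : ℝ) := by
    have h2 := Finset.card_union_le Y (J.biUnion X)
    have h3 : (J.biUnion X).card ≤ ∑ j ∈ J, (X j).card := Finset.card_biUnion_le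
    rw [hYc] at h2
    exact_mod_cast h2.trans (by omega)
  have h2 := Finset.card_le_card hsub
  have h3 := Finset.sum_le_sum hXj
  have h4 : ((S'.filter (fun x => -((B * t : ℝ) * γ) < inner ℝ (v x) (∑ y ∈ Y, v y))).card : ℝ) ≤
    (Y ∪ J.biUnion X).card := by exact_mod_cast h2
  linarith

/-- A large code contains a large equiangular subfamily. -/
theorem exists_equiangular (κ : Type) [Fintype κ] (β : ℝ) (hβ : 0 < β) (t : ℕ) :
    ∃ R : ℕ, ∀ {ι : Type} {n : ℕ} {b : ℝ} {J : Finset κ} {a : κ → ℝ}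
      {v : ι → EuclideanSpace ℝ (Fin n)} {S : Finset ι}, β ≤ b → IsCode b J a v S → R ≤ S.card →
      ∃ j ∈ J, ∃ Y ⊆ S, Y.card = t ∧ IsEquiangular (a j) v Y := by
  -- Colour `none` stands for negative pairs and asks for one point more than
  -- `card_le_of_inner_le_neg` allows. The size t + 2 in the other colours guarantees an actual
  -- pair, from which j ∈ J is read off.
  obtain ⟨R, hR0, hR⟩ := exists_monochromatic
    (fun c : Option κ => c.elim (⌊1 + 1 / β⌋₊ + 1) (fun _ => t + 2))
  refine ⟨R, fun {ι n b J a v S} hb h hS => ?_⟩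
  let f : ι → ι → Option κ := fun x y =>
    if hxy : ∃ j ∈ J, inner ℝ (v x) (v y) = a j then some hxy.choose else none
  have hf : ∀ x y, f x y = f y x := by
    intro x y
    simp only [f]
    rw [real_inner_comm]
  obtain ⟨c, Y, hY, hYc, hYf⟩ := hR S f hf hS
  rcases c with _ | j
  · exfalso
    have h1 := card_le_of_inner_le_neg (S := Y) (v := v) hβ zero_le_one
      (fun x hx => (h.unit x (hY hx)).le) (fun x hx y hy hne => by
        rcases h.pair x (hY hx) y (hY hy) hne with h1 | h1
        · linarith
        · have h2 := hYf x hx y hy hne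
          simp [f, h1] at h2)
    have h2 := Nat.lt_floor_add_one (1 + 1 / β)
    simp only [Option.elim] at hYc
    rw [hYc] at h1
    push_cast at h1
    linarith
  · have hval : ∀ x ∈ Y, ∀ y ∈ Y, x ≠ y → j ∈ J ∧ inner ℝ (v x) (v y) = a j := by
      intro x hx y hy hne
      have h2 := hYf x hx y hy hne
      simp only [f] at h2
      split_ifs at h2 with h3
      have h4 := h3.choose_spec
      rw [Option.some.inj h2] at h4
      exact h4
    simp only [Option.elim] at hYc
    obtain ⟨Y', hY', hY'c⟩ := Finset.exists_subset_card_eq (by omega : t ≤ Y.card)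
    obtain ⟨x, hx, y, hy, hne⟩ := Finset.one_lt_card.1 (by omega : 1 < Y.card)
    exact ⟨j, (hval x hx y hy hne).1, Y', hY'.trans hY, hY'c,
      fun x hx => h.unit x (hY (hY' hx)), fun x hx y hy hne => (hval x (hY' hx) y (hY' hy) hne).2⟩

end

/-! ### Bounds uniform near the limiting parameters -/

/-- A code all of whose subfamilies with pairwise inner products `a j₀` have fewer than `T`
members. -/
structure IsCodeFree {ι κ : Type} {n : ℕ} (T : ℕ∞) (j₀ : κ) (b : ℝ) (J : Finset κ) (a : κ → ℝ)
    (v : ι → EuclideanSpace ℝ (Fin n)) (S : Finset ι) : Prop extends IsCode b J a v S where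
  free : ∀ Y ⊆ S, IsEquiangular (a j₀) v Y → (Y.card : ℕ∞) < T

/-- For large `n` and parameters near `(β, α)`, codes in `ℝⁿ` without colour-`j₀` cliques of
size `T` have at most `f n` members. -/
def EvBound {κ : Type} (T : ℕ∞) (j₀ : κ) (J : Finset κ) (β : ℝ) (α : κ → ℝ) (f : ℕ → ℝ) : Prop :=
  ∀ᶠ p : ℕ × ℝ × (κ → ℝ) in atTop ×ˢ 𝓝 (β, α), ∀ (ι : Type)
    (v : ι → EuclideanSpace ℝ (Fin p.1)) (S : Finset ι),
    IsCodeFree T j₀ p.2.1 J p.2.2 v S → (S.card : ℝ) ≤ f p.1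

/-- The analogue of `EvBound` for codes whose members have a common projection, of squared norm
close to `ρ`, on some line. -/
def EvBoundProj {κ : Type} (T : ℕ∞) (j₀ : κ) (J : Finset κ) (β : ℝ) (α : κ → ℝ) (ρ : ℝ)
    (f : ℕ → ℝ) : Prop :=
  ∀ᶠ q : (ℕ × ℝ × (κ → ℝ)) × ℝ in (atTop ×ˢ 𝓝 (β, α)) ×ˢ 𝓝 ρ, ∀ (ι : Type)
    (v : ι → EuclideanSpace ℝ (Fin q.1.1)) (S : Finset ι) (w : EuclideanSpace ℝ (Fin q.1.1))
    (c : ℝ), IsCodeFree T j₀ q.1.2.1 J q.1.2.2 v S → w ≠ 0 → (∀ x ∈ S, inner ℝ (v x) w = c) →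
    c ^ 2 = q.2 * inner ℝ w w → (S.card : ℝ) ≤ f q.1.1

/-- The analogue of `EvBound` for subfamilies of codes all of whose members have inner product
`a j` with all members of a large clique of colour `i`. -/
def EvBoundClique {κ : Type} (T : ℕ∞) (j₀ : κ) (J : Finset κ) (β : ℝ) (α : κ → ℝ) (i j : κ)
    (f : ℕ → ℝ) : Prop :=
  ∀ᶠ t : ℕ in atTop, ∀ᶠ p : ℕ × ℝ × (κ → ℝ) in atTop ×ˢ 𝓝 (β, α), ∀ (ι : Type)
    (v : ι → EuclideanSpace ℝ (Fin p.1)) (S S' Y : Finset ι), IsCodeFree T j₀ p.2.1 J p.2.2 v S →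
    S' ⊆ S → Y ⊆ S → Y.card = t → IsEquiangular (p.2.2 i) v Y →
    (∀ x ∈ S', ∀ y ∈ Y, inner ℝ (v x) (v y) = p.2.2 j) → (S'.card : ℝ) ≤ f p.1

section
variable {κ : Type} {T : ℕ∞} {j₀ : κ} {J : Finset κ} {β : ℝ} {α : κ → ℝ} {f g : ℕ → ℝ} {ρ : ℝ}

theorem IsCodeFree.mono {ι : Type} {n : ℕ} {b : ℝ} {a : κ → ℝ}
    {v : ι → EuclideanSpace ℝ (Fin n)} {S S' : Finset ι} (h : IsCodeFree T j₀ b J a v S)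
    (hS : S' ⊆ S) : IsCodeFree T j₀ b J a v S' :=
  ⟨h.toIsCode.mono hS, fun Y hY => h.free Y (hY.trans hS)⟩

theorem IsCode.free_top {ι : Type} {n : ℕ} {b : ℝ} {a : κ → ℝ}
    {v : ι → EuclideanSpace ℝ (Fin n)} {S : Finset ι} (h : IsCode b J a v S) (j₀ : κ) :
    IsCodeFree ⊤ j₀ b J a v S :=
  ⟨h, fun _ _ _ => ENat.natCast_lt_top _⟩

theorem IsCodeFree.weaken {ι : Type} {n : ℕ} {b b' : ℝ} {a : κ → ℝ}
    {v : ι → EuclideanSpace ℝ (Fin n)} {S : Finset ι} (h : IsCodeFree T j₀ b J a v S)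
    {J' : Finset κ} (hb : b' ≤ b) (hJ : ∀ j ∈ J, j ∈ J' ∨ a j ≤ -b') :
    IsCodeFree T j₀ b' J' a v S := by
  refine ⟨⟨h.unit, fun x hx y hy hne => ?_⟩, h.free⟩
  rcases h.pair x hx y hy hne with h1 | ⟨j, hj, h1⟩
  · left; linarith
  · rcases hJ j hj with h2 | h2
    · exact Or.inr ⟨j, h2, h1⟩
    · left; linarith

/-- The map s ↦ (s - r)/(1 - r) on inner products is injective, so cliques of colour `j₀` upstairs
and downstairs correspond and the clique bound `T` is inherited. -/
theorem IsCodeFree.exists_projection {ι : Type} {n : ℕ} {b : ℝ} {a : κ → ℝ}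
    {v : ι → EuclideanSpace ℝ (Fin n)} {S : Finset ι} (h : IsCodeFree T j₀ b J a v S)
    {w : EuclideanSpace ℝ (Fin n)} {c r : ℝ} (hw : w ≠ 0)
    (hc : ∀ x ∈ S, inner ℝ (v x) w = c) (hr : c ^ 2 = r * inner ℝ w w) (hr1 : r < 1) :
    ∃ v' : ι → EuclideanSpace ℝ (Fin n),
      IsCodeFree T j₀ ((b + r) / (1 - r)) J (fun j => (a j - r) / (1 - r)) v' S := by
  obtain ⟨v', hv'⟩ := exists_normalized_projection hw hc hr hr1
  have hs : 0 < 1 - r := by linarith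
  refine ⟨v', ⟨fun x hx => ?_, fun x hx y hy hne => ?_⟩, fun Y hY hYe => h.free Y hY ?_⟩
  · rw [hv' x hx x hx, h.unit x hx, div_self hs.ne']
  · rw [hv' x hx y hy]
    rcases h.pair x hx y hy hne with h1 | ⟨j, hj, h1⟩
    · left
      rw [← neg_div]
      gcongr
      linarith
    · exact Or.inr ⟨j, hj, by rw [h1]⟩
  · refine ⟨fun x hx => h.unit x (hY hx), fun x hx y hy hne => ?_⟩
    have h1 := hYe.pair x hx y hy hne
    rw [hv' x (hY hx) y (hY hy), div_left_inj' hs.ne'] at h1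
    linarith

theorem EvBound.mono (h : EvBound T j₀ J β α f) (hfg : ∀ᶠ n in atTop, f n ≤ g n) :
    EvBound T j₀ J β α g := by
  have h2 : ∀ᶠ p : ℕ × ℝ × (κ → ℝ) in atTop ×ˢ 𝓝 (β, α), f p.1 ≤ g p.1 :=
    tendsto_fst.eventually hfg
  filter_upwards [h, h2] with p hp hp2 ι v S hS
  exact (hp ι v S hS).trans hp2

theorem EvBoundProj.mono (h : EvBoundProj T j₀ J β α ρ f) (hfg : ∀ᶠ n in atTop, f n ≤ g n) :
    EvBoundProj T j₀ J β α ρ g := by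
  have h2 : ∀ᶠ q : (ℕ × ℝ × (κ → ℝ)) × ℝ in (atTop ×ˢ 𝓝 (β, α)) ×ˢ 𝓝 ρ, f q.1.1 ≤ g q.1.1 :=
    (tendsto_fst.comp tendsto_fst).eventually hfg
  filter_upwards [h, h2] with p hp hp2 ι v S w c hS hw hc hr
  exact (hp ι v S w c hS hw hc hr).trans hp2

theorem EvBoundClique.mono {i j : κ} (h : EvBoundClique T j₀ J β α i j f)
    (hfg : ∀ᶠ n in atTop, f n ≤ g n) : EvBoundClique T j₀ J β α i j g := by
  have h2 : ∀ᶠ p : ℕ × ℝ × (κ → ℝ) in atTop ×ˢ 𝓝 (β, α), f p.1 ≤ g p.1 :=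
    tendsto_fst.eventually hfg
  filter_upwards [h] with t ht
  filter_upwards [ht, h2] with p hp hp2 ι v S S' Y hS hS' hYS hYc hY hSY
  exact (hp ι v S S' Y hS hS' hYS hYc hY hSY).trans hp2

theorem EvBoundProj.of_top (h : EvBoundProj ⊤ j₀ J β α ρ f) : EvBoundProj T j₀ J β α ρ f := by
  filter_upwards [h] with p hp ι v S w c hS hw hc hr
  exact hp ι v S w c (hS.toIsCode.free_top j₀) hw hc hr

/-- A colour whose value has become negative is absorbed into the negative range; this is how
projection lowers the number of values. -/
theorem EvBound.of_erase {j : κ} (h : EvBound T j₀ (J.erase j) (min β (-α j)) α f) :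
    EvBound T j₀ J β α f := by
  have ht : Tendsto (fun p : ℕ × ℝ × (κ → ℝ) => (p.1, min p.2.1 (-p.2.2 j), p.2.2))
      (atTop ×ˢ 𝓝 (β, α)) (atTop ×ˢ 𝓝 (min β (-α j), α)) := by
    refine tendsto_fst.prodMk (Tendsto.comp (g := fun x : ℝ × (κ → ℝ) => (min x.1 (-x.2 j), x.2))
      (y := 𝓝 (β, α)) ?_ tendsto_snd)
    exact Continuous.tendsto' (by fun_prop) _ _ rfl
  filter_upwards [ht.eventually h] with p hp ι v S hS
  refine hp ι v S (hS.weaken (min_le_left _ _) fun i hi => ?_)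
  by_cases hij : i = j
  · right
    have := min_le_right p.2.1 (-p.2.2 j)
    rw [hij]
    linarith
  · exact Or.inl (Finset.mem_erase.2 ⟨hij, hi⟩)

theorem EvBound.proj (hρ : ρ < 1)
    (h : EvBound T j₀ J ((β + ρ) / (1 - ρ)) (fun j => (α j - ρ) / (1 - ρ)) f) :
    EvBoundProj T j₀ J β α ρ f := by
  have ht : Tendsto (fun q : (ℕ × ℝ × (κ → ℝ)) × ℝ =>
      (q.1.1, (q.1.2.1 + q.2) / (1 - q.2), fun j => (q.1.2.2 j - q.2) / (1 - q.2)))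
      ((atTop ×ˢ 𝓝 (β, α)) ×ˢ 𝓝 ρ)
      (atTop ×ˢ 𝓝 ((β + ρ) / (1 - ρ), fun j => (α j - ρ) / (1 - ρ))) := by
    refine (tendsto_fst.comp tendsto_fst).prodMk ?_
    have h1 : Tendsto (fun q : (ℕ × ℝ × (κ → ℝ)) × ℝ => q.1.2.1)
        ((atTop ×ˢ 𝓝 (β, α)) ×ˢ 𝓝 ρ) (𝓝 β) :=
      ((continuous_fst.tendsto (β, α)).comp tendsto_snd).comp tendsto_fst
    have h2 : Tendsto (fun q : (ℕ × ℝ × (κ → ℝ)) × ℝ => q.1.2.2)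
        ((atTop ×ˢ 𝓝 (β, α)) ×ˢ 𝓝 ρ) (𝓝 α) :=
      ((continuous_snd.tendsto (β, α)).comp tendsto_snd).comp tendsto_fst
    have h3 : Tendsto (fun q : (ℕ × ℝ × (κ → ℝ)) × ℝ => q.2)
        ((atTop ×ˢ 𝓝 (β, α)) ×ˢ 𝓝 ρ) (𝓝 ρ) := tendsto_snd
    have h4 : (1 - ρ) ≠ 0 := by linarith
    have h5 := tendsto_pi_nhds.1 h2
    have h6 : Tendsto (fun (q : (ℕ × ℝ × (κ → ℝ)) × ℝ) j => (q.1.2.2 j - q.2) / (1 - q.2))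
        ((atTop ×ˢ 𝓝 (β, α)) ×ˢ 𝓝 ρ) (𝓝 fun j => (α j - ρ) / (1 - ρ)) :=
      tendsto_pi_nhds.2 fun j => ((h5 j).sub h3).div (h3.const_sub 1) h4
    exact Tendsto.prodMk_nhds ((h1.add h3).div (h3.const_sub 1) h4) h6
  have hlt : ∀ᶠ q : (ℕ × ℝ × (κ → ℝ)) × ℝ in (atTop ×ˢ 𝓝 (β, α)) ×ˢ 𝓝 ρ, q.2 < 1 :=
    tendsto_snd.eventually (eventually_lt_nhds hρ)
  filter_upwards [ht.eventually h, hlt] with q hq hq1 ι v S w c hS hw hc hr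
  obtain ⟨v', hv'⟩ := hS.exists_projection hw hc hr hq1
  exact hq ι v' S hv'

/-- The projection onto the sum of a clique of size t has squared norm a_j²/(a_i + (1 - a_i)/t),
which tends to α_j²/α_i. It is only close to the limit, hence the neighbourhood of `ρ` in
`EvBoundProj`. -/
theorem EvBoundProj.clique {i j : κ} (hi : 0 < α i)
    (h : EvBoundProj T j₀ J β α (α j ^ 2 / α i) f) : EvBoundClique T j₀ J β α i j f := by
  have ht : Tendsto (fun q : ℕ × (ℕ × ℝ × (κ → ℝ)) =>
      (q.2, q.2.2.2 j ^ 2 / (q.2.2.2 i + (1 - q.2.2.2 i) * (q.1 : ℝ)⁻¹)))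
      (atTop ×ˢ (atTop ×ˢ 𝓝 (β, α))) ((atTop ×ˢ 𝓝 (β, α)) ×ˢ 𝓝 (α j ^ 2 / α i)) := by
    refine tendsto_snd.prodMk ?_
    have h2 : Tendsto (fun q : ℕ × (ℕ × ℝ × (κ → ℝ)) => q.2.2.2)
        (atTop ×ˢ (atTop ×ˢ 𝓝 (β, α))) (𝓝 α) :=
      ((continuous_snd.tendsto (β, α)).comp tendsto_snd).comp tendsto_snd
    have h3 : Tendsto (fun q : ℕ × (ℕ × ℝ × (κ → ℝ)) => (q.1 : ℝ)⁻¹)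
        (atTop ×ˢ (atTop ×ˢ 𝓝 (β, α))) (𝓝 0) :=
      (tendsto_inv_atTop_zero.comp tendsto_natCast_atTop_atTop).comp tendsto_fst
    have hi' := (tendsto_pi_nhds.1 h2) i
    have := ((((tendsto_pi_nhds.1 h2) j).pow 2).div (hi'.add ((hi'.const_sub 1).mul h3))
      (by simpa using hi.ne'))
    simp only [mul_zero, add_zero] at this
    exact this
  have hpos : ∀ᶠ q : ℕ × (ℕ × ℝ × (κ → ℝ)) in atTop ×ˢ (atTop ×ˢ 𝓝 (β, α)),
      0 < q.2.2.2 i ∧ q.2.2.2 i < 2 * α i := by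
    have h2 : Tendsto (fun q : ℕ × (ℕ × ℝ × (κ → ℝ)) => q.2.2.2)
        (atTop ×ˢ (atTop ×ˢ 𝓝 (β, α))) (𝓝 α) :=
      ((continuous_snd.tendsto (β, α)).comp tendsto_snd).comp tendsto_snd
    exact ((tendsto_pi_nhds.1 h2) i).eventually
      ((eventually_gt_nhds hi).and (eventually_lt_nhds (by linarith)))
  -- Currying fixes `t` first; how large `n` must be and how near the parameters then may depend on
  -- `t`.
  have hcur := ((ht.eventually h).and hpos).curry
  filter_upwards [hcur, eventually_gt_atTop 1] with t ht ht0
  filter_upwards [ht] with p hp ι v S S' Y hS hS' _ hYc hY hSY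
  obtain ⟨hp, hpi, -⟩ := hp
  have ht1 : (1 : ℝ) < t := by exact_mod_cast ht0
  have hww : inner ℝ (∑ y ∈ Y, v y) (∑ y ∈ Y, v y) =
      (t : ℝ) ^ 2 * (p.2.2 i + (1 - p.2.2 i) * (t : ℝ)⁻¹) := by
    rw [hY.inner_sum_self, hYc]
    field_simp
    ring
  have hp1 : 0 < p.2.2 i + (1 - p.2.2 i) * (t : ℝ)⁻¹ := by
    have h1 : (t : ℝ)⁻¹ < 1 := inv_lt_one_of_one_lt₀ ht1
    have h2 : 0 < (t : ℝ)⁻¹ := by positivity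
    nlinarith
  refine hp ι v S' (∑ y ∈ Y, v y) (t * p.2.2 j) (hS.mono hS') ?_ (fun x hx => ?_) ?_
  · intro h0
    rw [h0, inner_zero_left] at hww
    have : (0 : ℝ) < (t : ℝ) ^ 2 * (p.2.2 i + (1 - p.2.2 i) * (t : ℝ)⁻¹) := by positivity
    linarith
  · rw [inner_sum, Finset.sum_congr rfl (hSY x hx), Finset.sum_const, nsmul_eq_mul, hYc]
  · rw [hww, div_mul_eq_mul_div, eq_div_iff hp1.ne']
    ring

end

/-! ### Crude polynomial bounds -/

/-- Codes with at most `m` nonnegative values have size `O(n ^ m)`. -/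
def PolyBound (κ : Type) (m : ℕ) : Prop :=
  ∀ (j₀ : κ) (J : Finset κ) (β : ℝ) (α : κ → ℝ), J.card ≤ m → 0 < β → Set.InjOn α J →
    (∀ j ∈ J, 0 ≤ α j ∧ α j < 1) → ∃ K : ℝ, 0 ≤ K ∧ EvBound ⊤ j₀ J β α (fun n => K * (n : ℝ) ^ m)

section
variable {κ : Type} {m : ℕ}

theorem PolyBound.of_card_filter_le (hm : PolyBound κ m) (j₀ : κ) (J : Finset κ) (β : ℝ)
    (α : κ → ℝ) (hβ : 0 < β) (hα : Set.InjOn α J) (hα1 : ∀ j ∈ J, α j < 1)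
    (hJ : (J.filter (fun j => 0 ≤ α j)).card ≤ m) :
    ∃ K : ℝ, 0 ≤ K ∧ EvBound ⊤ j₀ J β α (fun n => K * (n : ℝ) ^ m) := by
  induction hs : J.card generalizing J β with
  | zero =>
    rw [Finset.card_eq_zero] at hs
    subst hs
    exact hm j₀ ∅ β α (by simp) hβ (by simp) (by simp)
  | succ s ih =>
    by_cases hneg : ∀ j ∈ J, 0 ≤ α j
    · rw [Finset.filter_true_of_mem hneg] at hJ
      exact hm j₀ J β α hJ hβ hα fun j hj => ⟨hneg j hj, hα1 j hj⟩
    · push Not at hneg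
      obtain ⟨j, hj, hjneg⟩ := hneg
      obtain ⟨K, hK, h⟩ := ih (J.erase j) (min β (-α j)) (lt_min hβ (by linarith))
        (hα.mono (by simp)) (fun i hi => hα1 i (Finset.mem_of_mem_erase hi))
        ((Finset.card_le_card (Finset.filter_subset_filter _ (Finset.erase_subset _ _))).trans hJ)
        (by rw [Finset.card_erase_of_mem hj]; omega)
      exact ⟨K, hK, h.of_erase⟩

theorem PolyBound.proj (hm : PolyBound κ m) (j₀ : κ) (J : Finset κ) (β : ℝ)
    (α : κ → ℝ) (hβ : 0 < β) (hα : Set.InjOn α J) (hα1 : ∀ j ∈ J, α j < 1) {ρ : ℝ} (hρ : 0 ≤ ρ)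
    (hJ : (J.filter (fun j => ρ ≤ α j)).card ≤ m) :
    ∃ K : ℝ, 0 ≤ K ∧ EvBoundProj ⊤ j₀ J β α ρ (fun n => K * (n : ℝ) ^ m) := by
  rcases lt_or_ge ρ 1 with hρ1 | hρ1
  · have hs : 0 < 1 - ρ := by linarith
    obtain ⟨K, hK, h⟩ := hm.of_card_filter_le j₀ J ((β + ρ) / (1 - ρ))
      (fun j => (α j - ρ) / (1 - ρ)) (by positivity)
      (fun i hi j hj hij => hα hi hj (by
        simp only [div_left_inj' hs.ne'] at hij
        linarith))
      (fun j hj => by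
        rw [div_lt_one hs]
        linarith [hα1 j hj])
      (by simpa only [le_div_iff₀ hs, zero_mul, sub_nonneg] using hJ)
    exact ⟨K, hK, h.proj hρ1⟩
  -- For ρ ≥ 1 normalization is unavailable, but the projected vectors have squared norm at most g/3
  -- and pairwise inner products at most -g/3, so there are at most two.
  · obtain ⟨g, hg, hg1, hgJ⟩ : ∃ g > 0, g < 1 ∧ ∀ j ∈ J, α j < 1 - g := by
      have : ∀ᶠ g in 𝓝[>] (0 : ℝ), g < 1 ∧ ∀ j ∈ J, α j < 1 - g := by
        have h1 : ∀ᶠ g in 𝓝 (0 : ℝ), g < 1 := eventually_lt_nhds one_pos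
        refine Eventually.and (nhdsWithin_le_nhds h1) ?_
        rw [Finset.eventually_all]
        intro j hj
        have : ∀ᶠ g in 𝓝 (0 : ℝ), g < 1 - α j := eventually_lt_nhds (by linarith [hα1 j hj])
        filter_upwards [nhdsWithin_le_nhds this] with g hg
        linarith
      obtain ⟨g, h1, h2⟩ := (this.and self_mem_nhdsWithin).exists
      exact ⟨g, h2, h1⟩
    refine ⟨2, by norm_num, ?_⟩
    have hb : ∀ᶠ x : ℝ × (κ → ℝ) in 𝓝 (β, α), 0 < x.1 ∧ ∀ j ∈ J, x.2 j < 1 - g := by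
      refine (continuous_fst.tendsto (β, α)).eventually (eventually_gt_nhds hβ) |>.and ?_
      rw [Finset.eventually_all]
      intro j hj
      have : Tendsto (fun x : ℝ × (κ → ℝ) => x.2 j) (𝓝 (β, α)) (𝓝 (α j)) :=
        Continuous.tendsto (f := fun x : ℝ × (κ → ℝ) => x.2 j) (by fun_prop) (β, α)
      exact this.eventually (eventually_lt_nhds (hgJ j hj))
    have hb' : ∀ᶠ q : (ℕ × ℝ × (κ → ℝ)) × ℝ in (atTop ×ˢ 𝓝 (β, α)) ×ˢ 𝓝 ρ,
        0 < q.1.2.1 ∧ ∀ j ∈ J, q.1.2.2 j < 1 - g :=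
      (tendsto_snd.comp tendsto_fst).eventually hb
    have hr : ∀ᶠ q : (ℕ × ℝ × (κ → ℝ)) × ℝ in (atTop ×ˢ 𝓝 (β, α)) ×ˢ 𝓝 ρ,
        1 - g / 3 < q.2 := tendsto_snd.eventually (eventually_gt_nhds (by linarith))
    have hn : ∀ᶠ q : (ℕ × ℝ × (κ → ℝ)) × ℝ in (atTop ×ˢ 𝓝 (β, α)) ×ˢ 𝓝 ρ,
        1 ≤ q.1.1 := (tendsto_fst.comp tendsto_fst).eventually (eventually_ge_atTop 1)
    filter_upwards [hb', hr, hn] with q hq1 hq2 hq3 ι v S w c hS hw hc hr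
    obtain ⟨v', hv'⟩ := exists_projection hw hc hr
    have h1 := card_le_of_inner_le_neg (v := v') (S := S) (g := g / 3) (d := g / 3) (by positivity)
      (by positivity) (fun x hx => by rw [hv' x hx x hx, hS.unit x hx]; linarith)
      (fun x hx y hy hne => by
        rw [hv' x hx y hy]
        rcases hS.pair x hx y hy hne with h2 | ⟨j, hj, h2⟩
        · linarith [hq1.1]
        · linarith [hq1.2 j hj])
    rw [div_self (by positivity)] at h1
    have h2 : (1 : ℝ) ≤ (q.1.1 : ℝ) ^ m := one_le_pow₀ (by exact_mod_cast hq3)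
    linarith
end

/-! ### The rank bound in terms of degrees -/

section
variable {ι κ : Type} {n : ℕ} {b : ℝ} {J : Finset κ} {a : κ → ℝ}
  {v : ι → EuclideanSpace ℝ (Fin n)} {S : Finset ι}

/-- Test `v x` against z = Σ c_y v_y over its negative neighbours, c_y = -⟨x, y⟩. Then ⟨x, z⟩ = -W,
so W² ≤ ⟨z, z⟩. In ⟨z, z⟩ the diagonal gives at most W, the colours other than `j₀` give at most a_j
D_j W by AM–GM and symmetry, and `j₀` gives at most |a_{j₀}| (Σ c)² with Σ c ≤ W/b. Divide by W. -/
theorem sq_sum_inner_le_of_degree (h : IsCode b J a v S) (hb : 0 < b) {j₀ : κ}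
    {D : κ → ℝ} (hD : ∀ x ∈ S, ∀ j ∈ J.erase j₀,
      ((S.filter (fun y => y ≠ x ∧ inner ℝ (v x) (v y) = a j)).card : ℝ) ≤ D j)
    (hpos : ∀ j ∈ J.erase j₀, 0 ≤ a j) {x : ι} (hx : x ∈ S) :
    (∑ y ∈ S.filter (fun y => y ≠ x ∧ inner ℝ (v x) (v y) ≤ -b), inner ℝ (v x) (v y) ^ 2) *
      (1 - |a j₀| / b ^ 2) ≤ 1 + ∑ j ∈ J.erase j₀, a j * D j := by
  set N := S.filter (fun y => y ≠ x ∧ inner ℝ (v x) (v y) ≤ -b) with hN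
  have hNS : N ⊆ S := Finset.filter_subset _ _
  set c : ι → ℝ := fun y => -inner ℝ (v x) (v y) with hc
  have hcb : ∀ y ∈ N, b ≤ c y := fun y hy => by
    have := (Finset.mem_filter.1 hy).2.2
    simp only [hc]; linarith
  set W := ∑ y ∈ N, inner ℝ (v x) (v y) ^ 2 with hW
  have hWc : W = ∑ y ∈ N, c y ^ 2 := Finset.sum_congr rfl fun y _ => by simp [hc]
  have hW0 : 0 ≤ W := Finset.sum_nonneg fun _ _ => sq_nonneg _
  set z := ∑ y ∈ N, c y • v y with hz
  have hxz : inner ℝ (v x) z = -W := by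
    rw [hz, inner_sum, hWc, ← Finset.sum_neg_distrib]
    refine Finset.sum_congr rfl fun y _ => ?_
    rw [real_inner_smul_right]
    simp only [hc]; ring
  have hcs := real_inner_mul_inner_self_le (v x) z
  rw [h.unit x hx, hxz] at hcs
  let e : κ → ι → ι → ℝ := fun j y y' => if y' ≠ y ∧ inner ℝ (v y) (v y') = a j then 1 else 0
  have he0 : ∀ j y y', 0 ≤ e j y y' := fun j y y' => by simp only [e]; split_ifs <;> norm_num
  have hesymm : ∀ j y y', e j y y' = e j y' y := fun j y y' =>
    if_congr (by rw [ne_comm, real_inner_comm]) rfl rfl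
  have hedeg : ∀ j ∈ J.erase j₀, ∀ y ∈ N, ∑ y' ∈ N, e j y y' ≤ D j := by
    intro j hj y hy
    refine le_trans ?_ (hD y (hNS hy) j hj)
    simp only [e]
    rw [Finset.sum_boole]
    exact_mod_cast Finset.card_le_card (Finset.filter_subset_filter _ hNS)
  have hterm : ∀ y ∈ N, ∀ y' ∈ N, c y * c y' * inner ℝ (v y) (v y') ≤
      (if y = y' then c y ^ 2 else 0) + |a j₀| * (c y * c y') +
        ∑ j ∈ J.erase j₀, a j * (e j y y' * (c y ^ 2 / 2) + e j y y' * (c y' ^ 2 / 2)) := by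
    intro y hy y' hy'
    have hcy := hcb y hy
    have hcy' := hcb y' hy'
    have hcc : 0 ≤ c y * c y' := mul_nonneg (by linarith) (by linarith)
    have hsum0 : ∀ j ∈ J.erase j₀,
        0 ≤ a j * (e j y y' * (c y ^ 2 / 2) + e j y y' * (c y' ^ 2 / 2)) := fun j hj =>
      mul_nonneg (hpos j hj) (by have := he0 j y y'; positivity)
    have hs := Finset.sum_nonneg hsum0
    have hab : 0 ≤ |a j₀| * (c y * c y') := by positivity
    by_cases hyy : y = y'
    · subst hyy
      rw [if_pos rfl, h.unit y (hNS hy)]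
      nlinarith
    · rw [if_neg hyy]
      rcases h.pair y (hNS hy) y' (hNS hy') hyy with h1 | ⟨j, hj, h1⟩
      · have : c y * c y' * inner ℝ (v y) (v y') ≤ 0 :=
          mul_nonpos_of_nonneg_of_nonpos hcc (by linarith)
        linarith
      · by_cases hj0 : j = j₀
        · rw [h1, hj0]
          have := le_abs_self (a j₀)
          nlinarith
        · have hj' : j ∈ J.erase j₀ := Finset.mem_erase.2 ⟨hj0, hj⟩
          have h2 := Finset.single_le_sum hsum0 hj'
          have h3 : e j y y' = 1 := if_pos ⟨fun h => hyy h.symm, h1⟩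
          rw [h3] at h2
          rw [h1]
          have h4 : c y * c y' * a j ≤ a j * (1 * (c y ^ 2 / 2) + 1 * (c y' ^ 2 / 2)) := by
            have := hpos j hj'
            nlinarith [mul_nonneg this (sq_nonneg (c y - c y'))]
          linarith
  have hzz : inner ℝ z z ≤ W + |a j₀| * (∑ y ∈ N, c y) ^ 2 + (∑ j ∈ J.erase j₀, a j * D j) * W := by
    rw [hz, inner_sum_smul_sum_smul]
    refine (Finset.sum_le_sum fun y hy => Finset.sum_le_sum (hterm y hy)).trans ?_
    simp only [Finset.sum_add_distrib]
    have h1 : ∑ y ∈ N, ∑ y' ∈ N, (if y = y' then c y ^ 2 else 0) = W := by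
      rw [hWc]
      refine Finset.sum_congr rfl fun y hy => ?_
      rw [Finset.sum_ite_eq, if_pos hy]
    have h2 : ∑ y ∈ N, ∑ y' ∈ N, |a j₀| * (c y * c y') = |a j₀| * (∑ y ∈ N, c y) ^ 2 := by
      rw [sq, Finset.sum_mul_sum]
      simp only [Finset.mul_sum]
    have h3 : ∑ y ∈ N, ∑ y' ∈ N, ∑ j ∈ J.erase j₀,
        a j * (e j y y' * (c y ^ 2 / 2) + e j y y' * (c y' ^ 2 / 2)) ≤
        (∑ j ∈ J.erase j₀, a j * D j) * W := by
      have h4 : ∑ y ∈ N, ∑ y' ∈ N, ∑ j ∈ J.erase j₀,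
          a j * (e j y y' * (c y ^ 2 / 2) + e j y y' * (c y' ^ 2 / 2)) = ∑ j ∈ J.erase j₀,
          a j * ∑ y ∈ N, ∑ y' ∈ N, (e j y y' * (c y ^ 2 / 2) + e j y y' * (c y' ^ 2 / 2)) := by
        simp only [Finset.mul_sum]
        rw [Finset.sum_congr rfl fun y _ => Finset.sum_comm, Finset.sum_comm]
      rw [h4, Finset.sum_mul]
      refine Finset.sum_le_sum fun j hj => ?_
      rw [mul_assoc]
      refine mul_le_mul_of_nonneg_left ?_ (hpos j hj)
      have h5 : ∑ y ∈ N, ∑ y' ∈ N, e j y y' * (c y ^ 2 / 2) ≤ D j * W / 2 := by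
        have h6 : ∀ y ∈ N, ∑ y' ∈ N, e j y y' * (c y ^ 2 / 2) ≤ D j * (c y ^ 2 / 2) := by
          intro y hy
          rw [← Finset.sum_mul]
          exact mul_le_mul_of_nonneg_right (hedeg j hj y hy) (by positivity)
        refine (Finset.sum_le_sum h6).trans (le_of_eq ?_)
        rw [← Finset.mul_sum, hWc, ← Finset.sum_div]
        ring
      have h7 : ∑ y ∈ N, ∑ y' ∈ N, e j y y' * (c y' ^ 2 / 2) =
          ∑ y ∈ N, ∑ y' ∈ N, e j y y' * (c y ^ 2 / 2) := by
        rw [Finset.sum_comm]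
        refine Finset.sum_congr rfl fun y _ => Finset.sum_congr rfl fun y' _ => ?_
        rw [hesymm]
      simp only [Finset.sum_add_distrib]
      rw [h7]
      linarith
    linarith
  have hsumc : ∑ y ∈ N, c y ≤ W / b := by
    rw [hWc, le_div_iff₀ hb, Finset.sum_mul]
    refine Finset.sum_le_sum fun y hy => ?_
    have := hcb y hy
    nlinarith
  have hsumc0 : 0 ≤ ∑ y ∈ N, c y := Finset.sum_nonneg fun y hy => by linarith [hcb y hy]
  have hsq : (∑ y ∈ N, c y) ^ 2 ≤ W ^ 2 / b ^ 2 := by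
    rw [← div_pow]
    gcongr
  have hfin : W * (W * (1 - |a j₀| / b ^ 2)) ≤ W * (1 + ∑ j ∈ J.erase j₀, a j * D j) := by
    have h1 : |a j₀| * (∑ y ∈ N, c y) ^ 2 ≤ |a j₀| * (W ^ 2 / b ^ 2) := by gcongr
    have h2 : W * (W * (1 - |a j₀| / b ^ 2)) = W ^ 2 - |a j₀| * (W ^ 2 / b ^ 2) := by ring
    rw [h2]
    nlinarith
  rcases hW0.eq_or_lt with h0 | h0
  · rw [← h0, zero_mul]
    have : 0 ≤ ∑ j ∈ J.erase j₀, a j * D j := Finset.sum_nonneg fun j hj =>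
      mul_nonneg (hpos j hj) ((Nat.cast_nonneg _).trans (hD x hx j hj))
    linarith
  · exact le_of_mul_le_mul_left hfin h0

/-- Colour `j₀` contributes nothing after the shift; on the negative range |s| ≥ b, so the shift
costs at most a factor 1 + |a_{j₀}|/b. -/
theorem sum_sq_inner_sub_le_of_degree (h : IsCode b J a v S) (hb : 0 < b) {j₀ : κ}
    {D : κ → ℝ} (hD : ∀ x ∈ S, ∀ j ∈ J.erase j₀,
      ((S.filter (fun y => y ≠ x ∧ inner ℝ (v x) (v y) = a j)).card : ℝ) ≤ D j)
    (hpos : ∀ j ∈ J.erase j₀, 0 ≤ a j) (ha0 : |a j₀| < b ^ 2) {x : ι} (hx : x ∈ S) :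
    ∑ y ∈ S, (inner ℝ (v x) (v y) - a j₀) ^ 2 ≤
      (1 - a j₀) ^ 2 + ∑ j ∈ J.erase j₀, (a j - a j₀) ^ 2 * D j +
        (1 + |a j₀| / b) ^ 2 * ((1 + ∑ j ∈ J.erase j₀, a j * D j) / (1 - |a j₀| / b ^ 2)) := by
  have hW := sq_sum_inner_le_of_degree h hb hD hpos hx
  set N := S.filter (fun y => y ≠ x ∧ inner ℝ (v x) (v y) ≤ -b) with hN
  have hd : 0 < 1 - |a j₀| / b ^ 2 := by
    rw [sub_pos, div_lt_one (by positivity)]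
    exact ha0
  rw [← le_div_iff₀ hd] at hW
  let e : κ → ι → ℝ := fun j y => if y ≠ x ∧ inner ℝ (v x) (v y) = a j then 1 else 0
  have he0 : ∀ j y, 0 ≤ e j y := fun j y => by simp only [e]; split_ifs <;> norm_num
  have hterm : ∀ y ∈ S, (inner ℝ (v x) (v y) - a j₀) ^ 2 ≤ (if y = x then (1 - a j₀) ^ 2 else 0) +
      ∑ j ∈ J.erase j₀, (a j - a j₀) ^ 2 * e j y +
      if y ≠ x ∧ inner ℝ (v x) (v y) ≤ -b then
        (1 + |a j₀| / b) ^ 2 * inner ℝ (v x) (v y) ^ 2 else 0 := by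
    intro y hy
    have hsum0 : ∀ j ∈ J.erase j₀, 0 ≤ (a j - a j₀) ^ 2 * e j y := fun j hj =>
      mul_nonneg (sq_nonneg _) (he0 _ _)
    have hs := Finset.sum_nonneg hsum0
    have hl : 0 ≤ if y ≠ x ∧ inner ℝ (v x) (v y) ≤ -b then
        (1 + |a j₀| / b) ^ 2 * inner ℝ (v x) (v y) ^ 2 else 0 := by
      split_ifs <;> positivity
    by_cases hyx : y = x
    · subst hyx
      refine le_trans ?_ (le_add_of_nonneg_right hl)
      rw [if_pos rfl, h.unit y hy]
      linarith
    · rw [if_neg hyx]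
      rcases h.pair x hx y hy (fun e => hyx e.symm) with h1 | ⟨j, hj, h1⟩
      · rw [if_pos ⟨hyx, h1⟩]
        have h2 : |inner ℝ (v x) (v y) - a j₀| ≤ (1 + |a j₀| / b) * |inner ℝ (v x) (v y)| := by
          have h3 : b ≤ |inner ℝ (v x) (v y)| := by
            rw [abs_of_nonpos (by linarith)]; linarith
          have h4 : |a j₀| ≤ |a j₀| / b * |inner ℝ (v x) (v y)| := by
            rw [div_mul_eq_mul_div, le_div_iff₀ hb]
            gcongr
          have := abs_sub (inner ℝ (v x) (v y)) (a j₀)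
          linarith
        have h5 := pow_le_pow_left₀ (abs_nonneg _) h2 2
        rw [mul_pow, sq_abs, sq_abs] at h5
        linarith
      · by_cases hj0 : j = j₀
        · refine le_trans ?_ (le_add_of_nonneg_right hl)
          rw [h1, hj0, sub_self, zero_add, zero_pow two_ne_zero]
          exact hs
        · have hj' : j ∈ J.erase j₀ := Finset.mem_erase.2 ⟨hj0, hj⟩
          have h2 := Finset.single_le_sum hsum0 hj'
          have h3 : e j y = 1 := if_pos ⟨hyx, h1⟩
          rw [h3, mul_one, ← h1] at h2
          linarith
  refine (Finset.sum_le_sum hterm).trans ?_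
  rw [Finset.sum_add_distrib, Finset.sum_add_distrib, Finset.sum_ite_eq', if_pos hx,
    ← Finset.sum_filter, ← Finset.mul_sum]
  refine add_le_add (add_le_add le_rfl ?_) (mul_le_mul_of_nonneg_left hW (sq_nonneg _))
  rw [Finset.sum_comm]
  refine Finset.sum_le_sum fun j hj => ?_
  rw [← Finset.mul_sum]
  refine mul_le_mul_of_nonneg_left ?_ (sq_nonneg _)
  refine le_trans (le_of_eq ?_) (hD x hx j hj)
  simp only [e]
  rw [Finset.sum_boole]

theorem IsCode.card_mul_le_of_degree (h : IsCode b J a v S) (hb : 0 < b) {j₀ : κ}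
    {D : κ → ℝ} (hD : ∀ x ∈ S, ∀ j ∈ J.erase j₀,
      ((S.filter (fun y => y ≠ x ∧ inner ℝ (v x) (v y) = a j)).card : ℝ) ≤ D j)
    (hD0 : ∀ j ∈ J.erase j₀, 0 ≤ D j)
    (hpos : ∀ j ∈ J.erase j₀, 0 ≤ a j) (ha0 : |a j₀| < b ^ 2) :
    (S.card : ℝ) * (1 - a j₀) ^ 2 ≤ (n + 1) * (
      (1 - a j₀) ^ 2 + ∑ j ∈ J.erase j₀, (a j - a j₀) ^ 2 * D j +
        (1 + |a j₀| / b) ^ 2 * ((1 + ∑ j ∈ J.erase j₀, a j * D j) / (1 - |a j₀| / b ^ 2))) := by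
  -- The extra coordinate `none` carries the constant shift, so the inner dimension is n + 1.
  let A : Matrix S (Option (Fin n)) ℝ := fun x l => l.elim (-a j₀) (fun l => v x l)
  let B : Matrix (Option (Fin n)) S ℝ := fun l x => l.elim 1 (fun l => v x l)
  have hAB : ∀ x y : S, (A * B) x y = inner ℝ (v x) (v y) - a j₀ := by
    intro x y
    rw [Matrix.mul_apply, Fintype.sum_option, PiLp.inner_apply]
    simp only [A, B, Option.elim]
    have : ∀ i, inner ℝ ((v x) i) ((v y) i) = (v x) i * (v y) i := fun i => by
      simp [mul_comm]
    rw [Finset.sum_congr rfl fun i _ => this i]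
    ring
  have hsymm : (A * B).IsHermitian := by
    ext x y
    simp only [Matrix.conjTranspose_apply, star_trivial, hAB]
    rw [real_inner_comm]
  have hmain := card_mul_le_of_symm_factor A B hsymm
  have htr : (A * B).trace = S.card * (1 - a j₀) := by
    rw [Matrix.trace]
    have : ∀ x : S, (A * B).diag x = 1 - a j₀ := fun x => by
      rw [Matrix.diag_apply, hAB, h.unit x x.2]
    rw [Finset.sum_congr rfl fun x _ => this x]
    simp [mul_sub]
  set R := (1 - a j₀) ^ 2 + ∑ j ∈ J.erase j₀, (a j - a j₀) ^ 2 * D j +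
        (1 + |a j₀| / b) ^ 2 * ((1 + ∑ j ∈ J.erase j₀, a j * D j) / (1 - |a j₀| / b ^ 2)) with hR
  have hrow : ∑ x, ∑ y, (A * B) x y ^ 2 ≤ S.card * R := by
    have h1 : ∀ x : S, ∑ y, (A * B) x y ^ 2 ≤ R := by
      intro x
      simp only [hAB]
      rw [Finset.sum_coe_sort S (fun y => (inner ℝ (v x) (v y) - a j₀) ^ 2)]
      exact sum_sq_inner_sub_le_of_degree h hb hD hpos ha0 x.2
    refine (Finset.sum_le_sum fun x _ => h1 x).trans (le_of_eq ?_)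
    simp
  rw [htr, Fintype.card_option, Fintype.card_fin] at hmain
  push_cast at hmain
  have h2 : ((n : ℝ) + 1) * ∑ x, ∑ y, (A * B) x y ^ 2 ≤ (n + 1) * (S.card * R) := by gcongr
  rcases Nat.eq_zero_or_pos S.card with h0 | h0
  · rw [h0, Nat.cast_zero, zero_mul]
    have hd : 0 < 1 - |a j₀| / b ^ 2 := by
      rw [sub_pos, div_lt_one (by positivity)]
      exact ha0
    have h3 : 0 ≤ ∑ j ∈ J.erase j₀, (a j - a j₀) ^ 2 * D j :=
      Finset.sum_nonneg fun j hj => mul_nonneg (sq_nonneg _) (hD0 j hj)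
    have h4 : 0 ≤ ∑ j ∈ J.erase j₀, a j * D j :=
      Finset.sum_nonneg fun j hj => mul_nonneg (hpos j hj) (hD0 j hj)
    positivity
  · have h0' : (0 : ℝ) < S.card := by exact_mod_cast h0
    refine le_of_mul_le_mul_left (a := (S.card : ℝ)) ?_ h0'
    calc _ = ((S.card : ℝ) * (1 - a j₀)) ^ 2 := by ring
      _ ≤ _ := hmain.trans h2
      _ = _ := by ring

end

/-! ### The sharp bound and the crude bound it implies -/

/-- The asymptotically sharp form of the bound for codes with exactly `k` nonnegative values. -/
def SharpBound (κ : Type) (k : ℕ) : Prop :=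
  ∀ (j₀ : κ) (J : Finset κ) (β : ℝ) (α : κ → ℝ), J.card = k → j₀ ∈ J → 0 < β → Set.InjOn α J →
    (∀ j ∈ J, 0 ≤ α j ∧ α j < 1) → (∀ j ∈ J, α j₀ ≤ α j) → ∀ ε > 0,
    EvBound ⊤ j₀ J β α
      (fun n => ((1 + α j₀ / β) * (k - 1).factorial * 2 ^ k + ε) * (n : ℝ) ^ k)

variable {κ : Type}

theorem tendsto_params (β : ℝ) (α : κ → ℝ) :
    Tendsto (fun p : ℕ × ℝ × (κ → ℝ) => ((p.1 : ℝ)⁻¹, p.2.1, p.2.2)) (atTop ×ˢ 𝓝 (β, α))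
      (𝓝 (0, β, α)) := by
  have h1 : Tendsto (fun p : ℕ × ℝ × (κ → ℝ) => (p.1 : ℝ)⁻¹) (atTop ×ˢ 𝓝 (β, α)) (𝓝 0) :=
    (tendsto_inv_atTop_zero.comp tendsto_natCast_atTop_atTop).comp tendsto_fst
  exact h1.prodMk_nhds tendsto_snd

theorem eventually_mul_pow_le {K ε : ℝ} (hε : 0 < ε) (m : ℕ) :
    ∀ᶠ n : ℕ in atTop, K * (n : ℝ) ^ m ≤ ε * (n : ℝ) ^ (m + 1) := by
  filter_upwards [eventually_ge_atTop ⌈K / ε⌉₊] with n hn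
  have h1 : K / ε ≤ n := (Nat.le_ceil _).trans (by exact_mod_cast hn)
  rw [div_le_iff₀ hε] at h1
  calc K * (n : ℝ) ^ m ≤ (n * ε) * (n : ℝ) ^ m := by gcongr
    _ = _ := by ring

theorem SharpBound.polyBound {m : ℕ} (h : ∀ k ≤ m, 1 ≤ k → SharpBound κ k) : PolyBound κ m := by
  intro j₀ J β α hJ hβ hα hα1
  rcases J.eq_empty_or_nonempty with rfl | hne
  · refine ⟨1 + 1 / (β / 2), by positivity, ?_⟩
    have h1 : ∀ᶠ p : ℕ × ℝ × (κ → ℝ) in atTop ×ˢ 𝓝 (β, α), β / 2 < p.2.1 :=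
      ((continuous_fst.tendsto (β, α)).comp tendsto_snd).eventually
        (eventually_gt_nhds (by linarith : β / 2 < β))
    have h2 : ∀ᶠ p : ℕ × ℝ × (κ → ℝ) in atTop ×ˢ 𝓝 (β, α), 1 ≤ p.1 :=
      tendsto_fst.eventually (eventually_ge_atTop 1)
    filter_upwards [h1, h2] with p hp hp2 ι v S hS
    have h3 := card_le_of_inner_le_neg (v := v) (S := S) (g := β / 2) (d := 1) (by positivity)
      zero_le_one (fun x hx => (hS.unit x hx).le) (fun x hx y hy hxy => by
        rcases hS.pair x hx y hy hxy with h4 | ⟨j, hj, -⟩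
        · linarith
        · simp at hj)
    refine h3.trans (le_mul_of_one_le_right (by positivity) (one_le_pow₀ ?_))
    exact_mod_cast hp2
  · obtain ⟨j₁, hj₁, hmin⟩ := Finset.exists_min_image J α hne
    have hk : 1 ≤ J.card := hne.card_pos
    have h1 := h J.card hJ hk j₁ J β α rfl hj₁ hβ hα hα1 hmin 1 one_pos
    set K := (1 + α j₁ / β) * (J.card - 1).factorial * 2 ^ J.card + 1 with hK
    have hK0 : 0 ≤ K := by
      have := (hα1 j₁ hj₁).1
      positivity
    refine ⟨K, hK0, ?_⟩
    have h2 : EvBound ⊤ j₁ J β α (fun n => K * (n : ℝ) ^ m) := h1.mono <| by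
      filter_upwards [eventually_ge_atTop 1] with n hn
      have : (1 : ℝ) ≤ n := by exact_mod_cast hn
      gcongr
    filter_upwards [h2] with p hp ι v S hS
    exact hp ι v S (hS.toIsCode.free_top j₁)

/-! ### Smallest value equal to 0 in the limit -/

section
variable {j₀ : κ} {J : Finset κ} {β : ℝ} {α : κ → ℝ} {m : ℕ}

theorem SharpBound.degree (hm : 1 ≤ m) (hsharp : SharpBound κ m) (hpoly : PolyBound κ (m - 1))
    (hJ : J.card = m + 1) (hj₀ : j₀ ∈ J) (hβ : 0 < β) (hα : Set.InjOn α J)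
    (hα1 : ∀ j ∈ J, 0 ≤ α j ∧ α j < 1) (hmin : α j₀ = 0) {j : κ} (hj : j ∈ J.erase j₀) {ε : ℝ}
    (hε : 0 < ε) :
    EvBoundProj ⊤ j₀ J β α (α j ^ 2)
      (fun n => ((m - 1).factorial * 2 ^ m / α j + ε) * (n : ℝ) ^ m) := by
  have hpos : ∀ i ∈ J.erase j₀, 0 < α i := fun i hi => by
    have hi' := Finset.mem_of_mem_erase hi
    refine lt_of_le_of_ne (hα1 i hi').1 fun h0 => Finset.ne_of_mem_erase hi ?_
    exact hα hi' hj₀ (by rw [hmin, ← h0])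
  have hjpos := hpos j hj
  have hjlt := (hα1 j (Finset.mem_of_mem_erase hj)).2
  obtain ⟨j₁, hj₁, hmin₁⟩ := Finset.exists_min_image (J.erase j₀) α ⟨j, hj⟩
  set ρ := α j ^ 2 with hρ
  have hρ0 : 0 < ρ := by positivity
  have hρ1 : ρ < 1 := by rw [hρ]; nlinarith
  have hs : 0 < 1 - ρ := by linarith
  have hcard : (J.erase j₀).card = m := by rw [Finset.card_erase_of_mem hj₀, hJ]; rfl
  rcases le_or_gt ρ (α j₁) with hle | hlt
  · refine EvBound.proj hρ1 (EvBound.of_erase (j := j₀) ?_)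
    -- The value 0 moves to -ρ/(1 - ρ), which lies above the shifted -β and so becomes the new edge
    -- of the negative range.
    have hβ' : min ((β + ρ) / (1 - ρ)) (-((α j₀ - ρ) / (1 - ρ))) = ρ / (1 - ρ) := by
      rw [hmin, zero_sub, neg_div, neg_neg]
      refine min_eq_right ?_
      gcongr
      linarith
    rw [hβ']
    have h1 := hsharp j₁ (J.erase j₀) (ρ / (1 - ρ)) (fun j => (α j - ρ) / (1 - ρ)) hcard hj₁
      (by positivity) (fun a ha b hb hab => hα (Finset.mem_of_mem_erase ha)
        (Finset.mem_of_mem_erase hb) (by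
          simp only [div_left_inj' hs.ne'] at hab
          linarith))
      (fun i hi => ⟨div_nonneg (by linarith [hmin₁ i hi]) hs.le, by
        rw [div_lt_one hs]
        linarith [(hα1 i (Finset.mem_of_mem_erase hi)).2]⟩)
      (fun i hi => by
        have := hmin₁ i hi
        gcongr) ε hε
    have h2 : EvBound ⊤ j₁ (J.erase j₀) (ρ / (1 - ρ)) (fun j => (α j - ρ) / (1 - ρ))
        (fun n => ((m - 1).factorial * 2 ^ m / α j + ε) * (n : ℝ) ^ m) := h1.mono <| by
      refine Eventually.of_forall fun n => ?_
      -- The left side equals α_{j₁}/ρ, at most α_j/α_j² because `j₁` is minimal.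
      have h3 : 1 + (α j₁ - ρ) / (1 - ρ) / (ρ / (1 - ρ)) ≤ 1 / α j := by
        have h4 : 1 + (α j₁ - ρ) / (1 - ρ) / (ρ / (1 - ρ)) = α j₁ / ρ := by
          field_simp
          ring
        rw [h4, div_le_div_iff₀ hρ0 hjpos, hρ]
        nlinarith [hmin₁ j hj]
      have h5 : (1 + (α j₁ - ρ) / (1 - ρ) / (ρ / (1 - ρ))) * ((m - 1).factorial * 2 ^ m) ≤
          1 / α j * ((m - 1).factorial * 2 ^ m) := by gcongr
      refine mul_le_mul_of_nonneg_right ?_ (by positivity)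
      calc _ = (1 + (α j₁ - ρ) / (1 - ρ) / (ρ / (1 - ρ))) * ((m - 1).factorial * 2 ^ m) + ε := by
            ring
        _ ≤ 1 / α j * ((m - 1).factorial * 2 ^ m) + ε := by linarith
        _ = _ := by ring
    filter_upwards [h2] with p hp ι v S hS
    exact hp ι v S (hS.toIsCode.free_top j₁)
  -- Here both `j₀` and `j₁` become negative, so at most m - 1 values survive and the count is of
  -- lower order.
  · obtain ⟨K, hK, h⟩ := hpoly.proj j₀ J β α hβ hα (fun i hi => (hα1 i hi).2) hρ0.le (by
      have hsub : J.filter (fun i => ρ ≤ α i) ⊆ (J.erase j₀).erase j₁ := by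
        intro i hi
        obtain ⟨hi, hi'⟩ := Finset.mem_filter.1 hi
        refine Finset.mem_erase.2 ⟨?_, Finset.mem_erase.2 ⟨?_, hi⟩⟩
        · rintro rfl; linarith
        · rintro rfl; linarith
      refine (Finset.card_le_card hsub).trans ?_
      rw [Finset.card_erase_of_mem hj₁, hcard])
    refine h.mono ?_
    filter_upwards [eventually_mul_pow_le (K := K) hε (m - 1)] with n hn
    rw [Nat.sub_add_cancel hm] at hn
    refine hn.trans ?_
    have : 0 ≤ ((m - 1).factorial : ℝ) * 2 ^ m / α j := by positivity
    gcongr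
    linarith

theorem SharpBound.of_min_eq_zero (hsharp : 1 ≤ m → SharpBound κ m)
    (hpoly : 1 ≤ m → PolyBound κ (m - 1))
    (hJ : J.card = m + 1) (hj₀ : j₀ ∈ J) (hβ : 0 < β) (hα : Set.InjOn α J)
    (hα1 : ∀ j ∈ J, 0 ≤ α j ∧ α j < 1) (hmin : α j₀ = 0) {ε : ℝ}
    (hε : 0 < ε) :
    EvBound ⊤ j₀ J β α (fun n => (m.factorial * 2 ^ (m + 1) + ε) * (n : ℝ) ^ (m + 1)) := by
  have hpos : ∀ i ∈ J.erase j₀, 0 < α i := fun i hi => by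
    have hi' := Finset.mem_of_mem_erase hi
    refine lt_of_le_of_ne (hα1 i hi').1 fun h0 => Finset.ne_of_mem_erase hi ?_
    exact hα hi' hj₀ (by rw [hmin, ← h0])
  have hcard : (J.erase j₀).card = m := by rw [Finset.card_erase_of_mem hj₀, hJ]; rfl
  set ε₁ := ε / (2 * m + 2) with hε₁
  have hε₁0 : 0 < ε₁ := by positivity
  let d : κ → ℝ := fun j => (m - 1).factorial * 2 ^ m / α j + ε₁
  have hd0 : ∀ j ∈ J.erase j₀, 0 ≤ d j := fun j hj => by
    have := hpos j hj
    positivity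
  have hdeg : ∀ᶠ p : ℕ × ℝ × (κ → ℝ) in atTop ×ˢ 𝓝 (β, α), ∀ j ∈ J.erase j₀, ∀ (ι : Type)
      (v : ι → EuclideanSpace ℝ (Fin p.1)) (S : Finset ι), IsCode p.2.1 J p.2.2 v S → ∀ x ∈ S,
      ((S.filter (fun y => y ≠ x ∧ inner ℝ (v x) (v y) = p.2.2 j)).card : ℝ) ≤
        d j * (p.1 : ℝ) ^ m := by
    rw [Finset.eventually_all]
    intro j hj
    have hm : 1 ≤ m := by
      rw [← hcard]
      exact Finset.card_pos.2 ⟨j, hj⟩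
    have h1 := SharpBound.degree hm (hsharp hm) (hpoly hm) hJ hj₀ hβ hα hα1 hmin hj hε₁0
    have ht : Tendsto (fun p : ℕ × ℝ × (κ → ℝ) => (p, p.2.2 j ^ 2)) (atTop ×ˢ 𝓝 (β, α))
        ((atTop ×ˢ 𝓝 (β, α)) ×ˢ 𝓝 (α j ^ 2)) := by
      refine tendsto_id.prodMk ?_
      have : Tendsto (fun x : ℝ × (κ → ℝ) => x.2 j ^ 2) (𝓝 (β, α)) (𝓝 (α j ^ 2)) :=
        Continuous.tendsto (f := fun x : ℝ × (κ → ℝ) => x.2 j ^ 2) (by fun_prop) (β, α)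
      exact this.comp tendsto_snd
    filter_upwards [ht.eventually h1] with p hp ι v S hS x hx
    refine hp ι v _ (v x) (p.2.2 j) ((hS.mono (Finset.filter_subset _ _)).free_top j₀) ?_ ?_ ?_
    · intro h0
      have := hS.unit x hx
      rw [h0, inner_zero_left] at this
      exact zero_ne_one this
    · intro y hy
      rw [real_inner_comm]
      exact (Finset.mem_filter.1 hy).2.2
    · rw [hS.unit x hx, mul_one]
  let G : ℝ × ℝ × (κ → ℝ) → ℝ := fun p => (1 + p.1) * ((1 - p.2.2 j₀) ^ 2 * p.1 ^ m +
    ∑ j ∈ J.erase j₀, (p.2.2 j - p.2.2 j₀) ^ 2 * d j + (1 + |p.2.2 j₀| / p.2.1) ^ 2 *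
      ((p.1 ^ m + ∑ j ∈ J.erase j₀, p.2.2 j * d j) / (1 - |p.2.2 j₀| / p.2.1 ^ 2))) /
        (1 - p.2.2 j₀) ^ 2
  have hGc : ContinuousAt G (0, β, α) := by
    have h1 : (1 - |α j₀| / β ^ 2) ≠ 0 := by simp [hmin]
    have h2 : (1 - α j₀) ^ 2 ≠ 0 := by simp [hmin]
    have h3 : β ≠ 0 := hβ.ne'
    have h4 : β ^ 2 ≠ 0 := by positivity
    simp only [G]
    fun_prop (disch := assumption)
  have hG0 : G (0, β, α) < m.factorial * 2 ^ (m + 1) + ε := by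
    -- The term 2 · 0^m matters only for m = 0, where it is the whole constant 0! · 2; for m > 0 the
    -- sum over the other colours takes over.
    have h1 : G (0, β, α) = 2 * (0 : ℝ) ^ m + ∑ j ∈ J.erase j₀, (α j ^ 2 * d j + α j * d j) := by
      simp only [G, hmin, Finset.sum_add_distrib]
      simp
      ring
    have h2 : ∀ j ∈ J.erase j₀, α j ^ 2 * d j + α j * d j ≤
        2 * ((m - 1).factorial * 2 ^ m) + 2 * ε₁ := by
      intro j hj
      have hj0 := hpos j hj
      have hj1 := (hα1 j (Finset.mem_of_mem_erase hj)).2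
      have h3 : α j ^ 2 * d j + α j * d j =
          (1 + α j) * ((m - 1).factorial * 2 ^ m) + (α j ^ 2 + α j) * ε₁ := by
        simp only [d]
        field_simp
        ring
      rw [h3]
      have h4 : (0 : ℝ) ≤ (m - 1).factorial * 2 ^ m := by positivity
      gcongr
      · linarith
      · nlinarith
    have h3 := Finset.sum_le_card_nsmul _ _ _ h2
    rw [hcard, nsmul_eq_mul] at h3
    rw [h1]
    have h4 : (m : ℝ) * (2 * ε₁) < ε := by
      rw [hε₁]
      have : (0 : ℝ) ≤ m := by positivity
      rw [← mul_assoc, mul_div_assoc', div_lt_iff₀ (by positivity)]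
      nlinarith
    rcases Nat.eq_zero_or_pos m with h0 | h0
    · subst h0
      simp only [CharP.cast_eq_zero, zero_mul] at h3
      simp
      linarith
    · have h5 : (m.factorial : ℝ) = m * (m - 1).factorial := by
        exact_mod_cast (Nat.mul_factorial_pred h0.ne').symm
      rw [zero_pow h0.ne', h5, pow_succ]
      nlinarith
  have hGev : ∀ᶠ p : ℕ × ℝ × (κ → ℝ) in atTop ×ˢ 𝓝 (β, α),
      G ((p.1 : ℝ)⁻¹, p.2.1, p.2.2) < m.factorial * 2 ^ (m + 1) + ε :=
    (tendsto_params β α).eventually (hGc.eventually (eventually_lt_nhds hG0))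
  have hside : ∀ᶠ x : ℝ × (κ → ℝ) in 𝓝 (β, α), 0 < x.1 ∧ x.2 j₀ < 1 ∧ |x.2 j₀| < x.1 ^ 2 ∧
      ∀ j ∈ J.erase j₀, 0 < x.2 j := by
    have hc : ∀ j, Tendsto (fun x : ℝ × (κ → ℝ) => x.2 j) (𝓝 (β, α)) (𝓝 (α j)) := fun j =>
      Continuous.tendsto (f := fun x : ℝ × (κ → ℝ) => x.2 j) (by fun_prop) (β, α)
    have h1 : ∀ᶠ x : ℝ × (κ → ℝ) in 𝓝 (β, α), 0 < x.1 :=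
      (continuous_fst.tendsto (β, α)).eventually (eventually_gt_nhds hβ)
    have h2 : ∀ᶠ x : ℝ × (κ → ℝ) in 𝓝 (β, α), x.2 j₀ < 1 :=
      (hc j₀).eventually (eventually_lt_nhds (by rw [hmin]; norm_num))
    have h3 : ∀ᶠ x : ℝ × (κ → ℝ) in 𝓝 (β, α), |x.2 j₀| < x.1 ^ 2 := by
      refine Tendsto.eventually_lt (hc j₀).abs ((continuous_fst.tendsto (β, α)).pow 2) ?_
      rw [hmin, abs_zero]
      positivity
    have h4 : ∀ᶠ x : ℝ × (κ → ℝ) in 𝓝 (β, α), ∀ j ∈ J.erase j₀, 0 < x.2 j := by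
      rw [Finset.eventually_all]
      exact fun j hj => (hc j).eventually (eventually_gt_nhds (hpos j hj))
    filter_upwards [h1, h2, h3, h4] with x a b c d using ⟨a, b, c, d⟩
  have hside' : ∀ᶠ p : ℕ × ℝ × (κ → ℝ) in atTop ×ˢ 𝓝 (β, α), 0 < p.2.1 ∧ p.2.2 j₀ < 1 ∧
      |p.2.2 j₀| < p.2.1 ^ 2 ∧ ∀ j ∈ J.erase j₀, 0 < p.2.2 j := tendsto_snd.eventually hside
  have hn : ∀ᶠ p : ℕ × ℝ × (κ → ℝ) in atTop ×ˢ 𝓝 (β, α), 1 ≤ p.1 :=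
    tendsto_fst.eventually (eventually_ge_atTop 1)
  filter_upwards [hdeg, hGev, hside', hn] with p hp hpG hps hpn ι v S hS
  obtain ⟨hb, ha1, hab, hapos⟩ := hps
  have hnpos : (0 : ℝ) < p.1 := by exact_mod_cast hpn
  have hmain := hS.toIsCode.card_mul_le_of_degree hb (j₀ := j₀) (D := fun j => d j * (p.1 : ℝ) ^ m)
    (fun x hx j hj => hp j hj ι v S hS.toIsCode x hx)
    (fun j hj => mul_nonneg (hd0 j hj) (by positivity)) (fun j hj => (hapos j hj).le) hab
  have hs : 0 < (1 - p.2.2 j₀) ^ 2 := pow_pos (by linarith) 2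
  have hrhs : ((p.1 : ℝ) + 1) * ((1 - p.2.2 j₀) ^ 2 +
      ∑ j ∈ J.erase j₀, (p.2.2 j - p.2.2 j₀) ^ 2 * (d j * (p.1 : ℝ) ^ m) +
        (1 + |p.2.2 j₀| / p.2.1) ^ 2 * ((1 + ∑ j ∈ J.erase j₀, p.2.2 j * (d j * (p.1 : ℝ) ^ m)) /
          (1 - |p.2.2 j₀| / p.2.1 ^ 2))) =
      G ((p.1 : ℝ)⁻¹, p.2.1, p.2.2) * (p.1 : ℝ) ^ (m + 1) * (1 - p.2.2 j₀) ^ 2 := by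
    have hu : ((p.1 : ℝ)⁻¹) ^ m * (p.1 : ℝ) ^ m = 1 := by
      rw [← mul_pow, inv_mul_cancel₀ hnpos.ne', one_pow]
    have ht : (1 + (p.1 : ℝ)⁻¹) * p.1 = p.1 + 1 := by field_simp
    simp only [G, ← mul_assoc, ← Finset.sum_mul]
    set A := ∑ j ∈ J.erase j₀, (p.2.2 j - p.2.2 j₀) ^ 2 * d j
    set B := ∑ j ∈ J.erase j₀, p.2.2 j * d j
    set U := ((p.1 : ℝ)⁻¹) ^ m
    set V := (p.1 : ℝ) ^ m
    rw [← ht, pow_succ (p.1 : ℝ) m]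
    rw [show (1 : ℝ) + B * V = (U + B) * V by rw [add_mul, hu],
      show (1 - p.2.2 j₀) ^ 2 + A * V = ((1 - p.2.2 j₀) ^ 2 * U + A) * V by
        rw [add_mul, mul_assoc, hu, mul_one], div_mul_eq_mul_div, div_mul_cancel₀ _ hs.ne']
    ring
  rw [hrhs] at hmain
  have h2 := le_of_mul_le_mul_right hmain hs
  refine h2.trans ?_
  gcongr

end

/-! ### Decomposition along cliques -/

variable {T : ℕ∞} {j₀ : κ} {J : Finset κ} {β : ℝ} {α : κ → ℝ} {m : ℕ}

theorem exists_gap (hβ : 0 < β) (hα : Set.InjOn α J) (hα0 : ∀ j ∈ J, 0 ≤ α j) :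
    ∃ g > 0, ∀ᶠ x : ℝ × (κ → ℝ) in 𝓝 (β, α),
      (∀ j ∈ J, ∀ j' ∈ J, j ≠ j' → g ≤ |x.2 j - x.2 j'|) ∧ ∀ j ∈ J, g ≤ x.2 j + x.1 := by
  have hc : ∀ j, Tendsto (fun x : ℝ × (κ → ℝ) => x.2 j) (𝓝 (β, α)) (𝓝 (α j)) := fun j =>
    Continuous.tendsto (f := fun x : ℝ × (κ → ℝ) => x.2 j) (by fun_prop) (β, α)
  have h1 : ∀ᶠ g in 𝓝[>] (0 : ℝ), (∀ j ∈ J, ∀ j' ∈ J, j ≠ j' → g < |α j - α j'|) ∧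
      ∀ j ∈ J, g < α j + β := by
    refine Eventually.and ?_ ?_
    · rw [Finset.eventually_all]
      intro j hj
      rw [Finset.eventually_all]
      intro j' hj'
      by_cases hne : j = j'
      · exact Eventually.of_forall fun g h => absurd hne h
      · have h2 : 0 < |α j - α j'| := abs_pos.2 (sub_ne_zero.2 fun h => hne (hα hj hj' h))
        filter_upwards [nhdsWithin_le_nhds (eventually_lt_nhds h2)] with g hg _ using hg
    · rw [Finset.eventually_all]
      intro j hj
      have h2 : 0 < α j + β := by linarith [hα0 j hj]
      filter_upwards [nhdsWithin_le_nhds (eventually_lt_nhds h2)] with g hg using hg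
  obtain ⟨g, ⟨hg1, hg2⟩, hg0⟩ := (h1.and self_mem_nhdsWithin).exists
  refine ⟨g, hg0, Eventually.and ?_ ?_⟩
  · rw [Finset.eventually_all]
    intro j hj
    rw [Finset.eventually_all]
    intro j' hj'
    by_cases hne : j = j'
    · exact Eventually.of_forall fun g h => absurd hne h
    · filter_upwards [((hc j).sub (hc j')).abs.eventually
        (eventually_gt_nhds (hg1 j hj j' hj' hne))] with x hx _ using hx.le
  · rw [Finset.eventually_all]
    intro j hj
    filter_upwards [((hc j).add (continuous_fst.tendsto (β, α))).eventually
      (eventually_gt_nhds (hg2 j hj))] with x hx using hx.le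

/-- Decomposition of a code along boundedly many cliques with colours in `I`, given that every
large subcode contains such a clique. -/
theorem exists_evBound_of_cliques {I : Finset κ} (hI : I ⊆ J) (hβ : 0 < β)
    (hα : Set.InjOn α J) (hα0 : ∀ j ∈ J, 0 ≤ α j) {A : ℝ} (hA : ∀ i ∈ I, α i < A) {N : ℕ}
    (hN : A < N * β) {θ : ℝ} (hθ : 1 < θ) {F : κ → ℕ → ℝ} (hF0 : ∀ j n, 0 ≤ F j n)
    (hF : ∀ i ∈ I, ∀ j ∈ J, EvBoundClique T j₀ J β α i j (F j)) {R : ℕ → ℕ → ℝ}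
    (hR : ∀ t, ∀ᶠ p : ℕ × ℝ × (κ → ℝ) in atTop ×ˢ 𝓝 (β, α), ∀ (ι : Type)
      (v : ι → EuclideanSpace ℝ (Fin p.1)) (S : Finset ι), IsCodeFree T j₀ p.2.1 J p.2.2 v S →
      R t p.1 < S.card → ∃ i ∈ I, ∃ Y ⊆ S, Y.card = t ∧ IsEquiangular (p.2.2 i) v Y) :
    ∃ t : ℕ, EvBound T j₀ J β α (fun n => N * (t + θ * ∑ j ∈ J, F j n) + R t n) := by
  obtain ⟨g, hg, hgap⟩ := exists_gap hβ hα hα0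
  obtain ⟨q, hq⟩ := exists_nat_gt (4 / g ^ 2)
  rw [div_lt_iff₀ (by positivity)] at hq
  set r : ℝ := J.card * q with hr
  have hr0 : 0 ≤ r := by positivity
  -- `B` is large enough that discarding the at most r exceptional blocks costs only the factor `θ`.
  obtain ⟨B, hB1, hB2⟩ : ∃ B : ℕ, (J.card + 1) * q < B ∧ (B : ℝ) / (B - r) ≤ θ := by
    obtain ⟨B, hB⟩ := exists_nat_gt (max ((J.card + 1) * q : ℝ) (θ * r / (θ - 1)))
    have h1 := (le_max_left _ _).trans_lt hB
    have h2 := (le_max_right _ _).trans_lt hB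
    refine ⟨B, by exact_mod_cast h1, ?_⟩
    rw [div_lt_iff₀ (by linarith)] at h2
    have h3 : 0 < (B : ℝ) - r := by
      have : (0 : ℝ) ≤ q := by positivity
      rw [hr]; linarith
    rw [div_le_iff₀ h3]
    linarith
  have hBpos : 0 < B := by omega
  have hrB : r < B := by
    have h1 : ((J.card + 1) * q : ℝ) < B := by exact_mod_cast hB1
    have : (0 : ℝ) ≤ q := by positivity
    rw [hr]; linarith
  obtain ⟨A₁, hA₁, hA₁A⟩ : ∃ A₁, (∀ i ∈ I, α i < A₁) ∧ A₁ < A := by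
    have h1 : ∀ᶠ x in 𝓝[<] A, ∀ i ∈ I, α i < x := by
      rw [Finset.eventually_all]
      intro i hi
      exact nhdsWithin_le_nhds (eventually_gt_nhds (hA i hi))
    exact (h1.and self_mem_nhdsWithin).exists
  obtain ⟨β₁, hβ₁, hβ₁0, hβ₁β⟩ : ∃ β₁, A < N * β₁ ∧ 0 < β₁ ∧ β₁ < β := by
    have h1 : ∀ᶠ x in 𝓝[<] β, A < N * x := nhdsWithin_le_nhds
      (((continuous_const_mul (N : ℝ)).tendsto β).eventually (eventually_gt_nhds hN))
    have h2 : ∀ᶠ x in 𝓝[<] β, 0 < x := nhdsWithin_le_nhds (eventually_gt_nhds hβ)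
    obtain ⟨x, ⟨hx1, hx2⟩, hx3⟩ := ((h1.and h2).and self_mem_nhdsWithin).exists
    exact ⟨x, hx1, hx2, hx3⟩
  obtain ⟨γ, hγ, hγβ₁⟩ : ∃ γ, A < N * γ ∧ γ < β₁ := by
    have h1 : ∀ᶠ x in 𝓝[<] β₁, A < N * x := nhdsWithin_le_nhds
      (((continuous_const_mul (N : ℝ)).tendsto β₁).eventually (eventually_gt_nhds hβ₁))
    exact (h1.and self_mem_nhdsWithin).exists
  have hFall : ∀ᶠ t : ℕ in atTop, ∀ i ∈ I, ∀ j ∈ J, ∀ᶠ p : ℕ × ℝ × (κ → ℝ) in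
      atTop ×ˢ 𝓝 (β, α), ∀ (ι : Type) (v : ι → EuclideanSpace ℝ (Fin p.1)) (S S' Y : Finset ι),
      IsCodeFree T j₀ p.2.1 J p.2.2 v S → S' ⊆ S → Y ⊆ S → Y.card = t →
      IsEquiangular (p.2.2 i) v Y →
      (∀ x ∈ S', ∀ y ∈ Y, inner ℝ (v x) (v y) = p.2.2 j) → (S'.card : ℝ) ≤ F j p.1 := by
    rw [Finset.eventually_all]
    intro i hi
    rw [Finset.eventually_all]
    exact fun j hj => hF i hi j hj
  have hlarge : ∀ C : ℝ, ∀ᶠ t : ℕ in atTop, C ≤ t := fun C =>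
    tendsto_natCast_atTop_atTop.eventually (eventually_ge_atTop C)
  -- With T = B t, the second bound absorbs the diagonal, (1 - a)T + a T² ≤ A T², and the third
  -- absorbs the exceptions, T γ ≤ β₁ (T - r) - r.
  obtain ⟨t, ⟨⟨ht, htpos⟩, ht2⟩, ht3⟩ := (((hFall.and (eventually_gt_atTop 0)).and
    (hlarge (2 / (A - A₁)))).and (hlarge (r * (β₁ + 1) / (β₁ - γ)))).exists
  have hBt : (t : ℝ) ≤ B * t := by
    have : (1 : ℝ) ≤ B := by exact_mod_cast hBpos
    have h0 : (0 : ℝ) ≤ t := by positivity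
    nlinarith
  have ht' : ∀ᶠ p : ℕ × ℝ × (κ → ℝ) in
      atTop ×ˢ 𝓝 (β, α), ∀ i ∈ I, ∀ j ∈ J, ∀ (ι : Type) (v : ι → EuclideanSpace ℝ (Fin p.1))
      (S S' Y : Finset ι), IsCodeFree T j₀ p.2.1 J p.2.2 v S → S' ⊆ S → Y ⊆ S → Y.card = t →
      IsEquiangular (p.2.2 i) v Y →
      (∀ x ∈ S', ∀ y ∈ Y, inner ℝ (v x) (v y) = p.2.2 j) → (S'.card : ℝ) ≤ F j p.1 := by
    rw [Finset.eventually_all]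
    intro i hi
    rw [Finset.eventually_all]
    exact fun j hj => ht i hi j hj
  refine ⟨B * t, ?_⟩
  have hab : ∀ᶠ x : ℝ × (κ → ℝ) in 𝓝 (β, α), β₁ < x.1 ∧ ∀ i ∈ I, -1 < x.2 i ∧ x.2 i < A₁ := by
    refine ((continuous_fst.tendsto (β, α)).eventually (eventually_gt_nhds hβ₁β)).and ?_
    rw [Finset.eventually_all]
    intro i hi
    have hc : Tendsto (fun x : ℝ × (κ → ℝ) => x.2 i) (𝓝 (β, α)) (𝓝 (α i)) :=
      Continuous.tendsto (f := fun x : ℝ × (κ → ℝ) => x.2 i) (by fun_prop) (β, α)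
    exact (hc.eventually (eventually_gt_nhds (by linarith [hα0 i (hI hi)]))).and
      (hc.eventually (eventually_lt_nhds (hA₁ i hi)))
  filter_upwards [ht', tendsto_snd.eventually hgap, tendsto_snd.eventually hab, hR (B * t)]
    with p hp hpg hpab hpR ι v S hS
  obtain ⟨hsep, hneg⟩ := hpg
  obtain ⟨hb, ha⟩ := hpab
  have hTpos : 0 < B * t := Nat.mul_pos hBpos htpos
  have hTr : (0 : ℝ) < (B * t : ℝ) := by exact_mod_cast hTpos
  have hsum0 : 0 ≤ ∑ j ∈ J, F j p.1 := Finset.sum_nonneg fun j _ => hF0 j _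
  refine card_le_of_blocks (v := v) (T := B * t) hTpos hγ (by positivity) fun S' hS' hcard => ?_
  obtain ⟨i, hi, Y, hY, hYc, hYe⟩ := hpR ι v S' (hS.mono hS') hcard
  obtain ⟨hai, hai'⟩ := ha i hi
  refine ⟨Y, hY, hYc, ?_, ?_⟩
  · rw [hYe.inner_sum_self, hYc]
    push_cast
    rw [div_le_iff₀ (by linarith)] at ht2
    have h1 : 2 ≤ (B * t : ℝ) * (A - A₁) := by nlinarith
    nlinarith
  · have h1 := hS.toIsCode.card_filter_le_of_block (by linarith) hS' hY hYe hai.le hg hsep hneg hq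
      hB1 htpos hYc (γ := γ) (by
        rw [div_le_iff₀ (by linarith)] at ht3
        have h2 : r * (β₁ + 1) ≤ (B * t : ℝ) * (β₁ - γ) := by nlinarith
        have h3 : (0 : ℝ) ≤ B * t - r := by
          have h4 : (1 : ℝ) ≤ t := by exact_mod_cast htpos
          nlinarith
        have h4 : β₁ * (B * t - r) ≤ p.2.1 * (B * t - r) := by gcongr
        linarith) (fun j => F j p.1)
      (fun j hj X hX Y' hY' hY'c hXY => hp i hi j hj ι v S X Y' hS (hX.trans hS')
        (hY'.trans (hY.trans hS')) hY'c (hYe.mono hY') hXY)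
    push_cast
    refine h1.trans ?_
    rw [← Finset.mul_sum]
    gcongr

/-! ### Codes without large cliques in the smallest value -/

theorem IsCodeFree.free_of_forall_inner_eq {ι : Type} {n : ℕ} {b : ℝ} {a : κ → ℝ}
    {v : ι → EuclideanSpace ℝ (Fin n)} {S S' : Finset ι} {t : ℕ}
    (h : IsCodeFree (t + 1 : ℕ) j₀ b J a v S) (ha : a j₀ < 1) (hS' : S' ⊆ S) {y : ι} (hy : y ∈ S)
    (hSy : ∀ x ∈ S', inner ℝ (v x) (v y) = a j₀) : IsCodeFree (t : ℕ) j₀ b J a v S' := by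
  refine ⟨h.toIsCode.mono hS', fun Z hZ hZe => ?_⟩
  have hyZ : y ∉ Z := fun hyZ => by
    have h1 := hSy y (hZ hyZ)
    rw [h.unit y hy] at h1
    linarith
  have h1 := h.free (insert y Z) (Finset.insert_subset hy (hZ.trans hS')) ⟨?_, ?_⟩
  · rw [Finset.card_insert_of_notMem hyZ] at h1
    have h2 : Z.card + 1 < t + 1 := by exact_mod_cast h1
    exact_mod_cast (by omega : Z.card < t)
  · intro x hx
    rcases Finset.mem_insert.1 hx with rfl | hx
    · exact h.unit _ hy
    · exact hZe.unit x hx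
  · intro x hx x' hx' hne
    rcases Finset.mem_insert.1 hx with h1 | h1 <;> rcases Finset.mem_insert.1 hx' with h2 | h2
    · exact absurd (h1.trans h2.symm) hne
    · rw [h1, real_inner_comm]; exact hSy x' (hZ h2)
    · rw [h2]; exact hSy x (hZ h1)
    · exact hZe.pair x h1 x' h2 hne

theorem exists_common_bound {I : Finset κ}
    (h : ∀ i ∈ I, ∀ j ∈ J, ∃ K : ℝ, 0 ≤ K ∧
      EvBoundClique T j₀ J β α i j (fun n => K * (n : ℝ) ^ m)) :
    ∃ K : ℝ, 0 ≤ K ∧ ∀ i ∈ I, ∀ j ∈ J,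
      EvBoundClique T j₀ J β α i j (fun n => K * (n : ℝ) ^ m) := by
  choose! K hK0 hK using h
  refine ⟨∑ i ∈ I, ∑ j ∈ J, K i j, Finset.sum_nonneg fun i hi => Finset.sum_nonneg fun j hj =>
    hK0 i hi j hj, fun i hi j hj => (hK i hi j hj).mono (Eventually.of_forall fun n => ?_)⟩
  have h1 : K i j ≤ ∑ j ∈ J, K i j := Finset.single_le_sum (f := K i) (hK0 i hi) hj
  have h2 : ∑ j ∈ J, K i j ≤ ∑ i ∈ I, ∑ j ∈ J, K i j :=
    Finset.single_le_sum (f := fun i => ∑ j ∈ J, K i j)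
      (fun i hi => Finset.sum_nonneg fun j hj => hK0 i hi j hj) hi
  have := h1.trans h2
  gcongr

/-- Codes without large cliques in the smallest nonnegative value have size `O(n ^ m)`, where
`m + 1` is the number of values. -/
theorem exists_evBound_of_free [Fintype κ] (hpoly : PolyBound κ m) (hJ : J.card = m + 1)
    (hj₀ : j₀ ∈ J) (t : ℕ) (hβ : 0 < β) (hα : Set.InjOn α J) (hα1 : ∀ j ∈ J, 0 ≤ α j ∧ α j < 1)
    (hmin : ∀ j ∈ J, α j₀ ≤ α j) :
    ∃ K : ℝ, 0 ≤ K ∧ EvBound (t : ℕ) j₀ J β α (fun n => K * (n : ℝ) ^ m) := by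
  induction t generalizing β α with
  | zero =>
    refine ⟨0, le_rfl, Eventually.of_forall fun p ι v S hS => ?_⟩
    have := hS.free ∅ (by simp) ⟨by simp, by simp⟩
    simp at this
  | succ t iht =>
  obtain ⟨g, hg0, hg1⟩ : ∃ g > 0, ∀ j ∈ J.erase j₀, α j₀ + g < α j := by
    have h1 : ∀ᶠ g in 𝓝[>] (0 : ℝ), ∀ j ∈ J.erase j₀, α j₀ + g < α j := by
      rw [Finset.eventually_all]
      intro j hj
      have hj' := Finset.mem_of_mem_erase hj
      have h2 : α j₀ < α j := lt_of_le_of_ne (hmin j hj') fun h =>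
        Finset.ne_of_mem_erase hj (hα hj' hj₀ h.symm)
      have h3 : ∀ᶠ g in 𝓝 (0 : ℝ), g < α j - α j₀ := eventually_lt_nhds (by linarith)
      filter_upwards [nhdsWithin_le_nhds h3] with g hg
      linarith
    obtain ⟨g, h2, h3⟩ := (h1.and self_mem_nhdsWithin).exists
    exact ⟨g, h3, h2⟩
  replace hg1 : ∀ j ∈ J.erase j₀, α j₀ + g ≤ α j := fun j hj => (hg1 j hj).le
  -- Inner induction: `M` bounds the smallest value in units of g³. A projection that keeps all
  -- values nonnegative lowers it by at least g³ and does not shrink the gap `g`.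
  obtain ⟨M, hM⟩ := exists_nat_gt (α j₀ / g ^ 3)
  rw [div_lt_iff₀ (by positivity)] at hM
  induction M generalizing β α with
  | zero =>
    exfalso
    have := (hα1 j₀ hj₀).1
    simp at hM
    linarith
  | succ M ihM =>
  have hclique : ∀ i ∈ J.erase j₀, ∀ j ∈ J, ∃ K : ℝ, 0 ≤ K ∧
      EvBoundClique (t + 1 : ℕ) j₀ J β α i j (fun n => K * (n : ℝ) ^ m) := by
    intro i hi j hj
    have hi' := Finset.mem_of_mem_erase hi
    have h0 := (hα1 j₀ hj₀).1
    have hipos : 0 < α i := by linarith [hg1 i hi]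
    by_cases hjj : j = j₀
    -- Vectors at the smallest value from a member of the clique form a code whose cliques of that
    -- colour are one smaller, so the outer induction on `t` applies.
    · subst hjj
      obtain ⟨K, hK, h⟩ := iht hβ hα hα1 hmin
      refine ⟨K, hK, ?_⟩
      have ha : ∀ᶠ p : ℕ × ℝ × (κ → ℝ) in atTop ×ˢ 𝓝 (β, α), p.2.2 j < 1 := by
        have hc : Tendsto (fun x : ℝ × (κ → ℝ) => x.2 j) (𝓝 (β, α)) (𝓝 (α j)) :=
          Continuous.tendsto (f := fun x : ℝ × (κ → ℝ) => x.2 j) (by fun_prop) (β, α)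
        exact (hc.comp tendsto_snd).eventually (eventually_lt_nhds (hα1 j hj).2)
      filter_upwards [eventually_gt_atTop 0] with s hs
      filter_upwards [h, ha] with p hp hpa ι v S S' Y hS hS' hYS hYc _ hSY
      obtain ⟨y, hy⟩ := Finset.card_pos.1 (hYc ▸ hs)
      exact hp ι v S' (hS.free_of_forall_inner_eq hpa hS' (hYS hy) fun x hx => hSY x hx y hy)
    · have hje : j ∈ J.erase j₀ := Finset.mem_erase.2 ⟨hjj, hj⟩
      have hgj := hg1 j hje
      have hj1 := (hα1 j hj).2
      have hi1 := (hα1 i hi').2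
      set ρ := α j ^ 2 / α i with hρ
      have hρg : g ^ 2 ≤ ρ := by
        rw [hρ, le_div_iff₀ hipos]
        have : g ^ 2 ≤ α j ^ 2 := by
          gcongr
          linarith
        nlinarith [sq_nonneg g]
      have hρ0 : 0 ≤ ρ := by positivity
      rcases lt_or_ge (α j₀) ρ with hlt | hle
      · obtain ⟨K, hK, h⟩ := hpoly.proj j₀ J β α hβ hα (fun i hi => (hα1 i hi).2) hρ0 (by
          have hsub : J.filter (fun i => ρ ≤ α i) ⊆ J.erase j₀ := by
            intro i hi
            obtain ⟨hi, hi'⟩ := Finset.mem_filter.1 hi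
            refine Finset.mem_erase.2 ⟨?_, hi⟩
            rintro rfl; linarith
          refine (Finset.card_le_card hsub).trans ?_
          rw [Finset.card_erase_of_mem hj₀, hJ]; rfl)
        exact ⟨K, hK, h.of_top.clique hipos⟩
      · have hα01 := (hα1 j₀ hj₀).2
        have hs : 0 < 1 - ρ := by linarith
        have hdiv : ∀ i i', α i ≤ α i' → (α i - ρ) / (1 - ρ) ≤ (α i' - ρ) / (1 - ρ) := by
          intro i i' hii
          gcongr
        obtain ⟨K, hK, h⟩ := ihM (β := (β + ρ) / (1 - ρ)) (α := fun j => (α j - ρ) / (1 - ρ))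
          (by positivity)
          (fun a ha b hb hab => hα ha hb (by
            simp only [div_left_inj' hs.ne'] at hab
            linarith))
          (fun i hi => ⟨div_nonneg (by linarith [hmin i hi]) hs.le, by
            rw [div_lt_one hs]
            linarith [(hα1 i hi).2]⟩)
          (fun i hi => hdiv _ _ (hmin i hi))
          (fun i hi => by
            have := hg1 i hi
            rw [div_add' _ _ _ hs.ne', div_le_div_iff_of_pos_right hs]
            nlinarith)
          (by
            -- The drop is ρ(1 - α_{j₀})/(1 - ρ), with ρ ≥ g² and 1 - α_{j₀} ≥ g.
            have h1 : (α j₀ - ρ) / (1 - ρ) ≤ α j₀ - g ^ 3 := by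
              rw [div_le_iff₀ hs]
              have h2 : g ^ 2 * g ≤ ρ * (1 - α j₀) := by
                have : g ≤ 1 - α j₀ := by linarith
                gcongr
              have h3 : 0 < g ^ 3 := by positivity
              nlinarith
            push_cast at hM
            linarith)
        exact ⟨K, hK, (h.proj (by linarith)).clique hipos⟩
  obtain ⟨K, hK, hF⟩ := exists_common_bound hclique
  choose R hR using fun s : ℕ => exists_equiangular κ (β / 2) (by positivity) s
  obtain ⟨N, hN⟩ := exists_nat_gt (1 / β)
  rw [div_lt_iff₀ hβ] at hN
  obtain ⟨s, h⟩ := exists_evBound_of_cliques (T := (t + 1 : ℕ)) (j₀ := j₀) (I := J.erase j₀)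
    (Finset.erase_subset _ _) hβ hα (fun j hj => (hα1 j hj).1) (A := 1)
    (fun i hi => (hα1 i (Finset.mem_of_mem_erase hi)).2) hN one_lt_two
    (F := fun _ n => K * (n : ℝ) ^ m) (fun _ n => by positivity) hF
    -- A Ramsey clique of size at least t + 1 cannot have colour `j₀`, so its colour lies in
    -- `J.erase j₀`.
    (R := fun s _ => R (max s (t + 1))) (by
      intro s
      have hb : ∀ᶠ p : ℕ × ℝ × (κ → ℝ) in atTop ×ˢ 𝓝 (β, α), β / 2 < p.2.1 :=
        ((continuous_fst.tendsto (β, α)).comp tendsto_snd).eventually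
          (eventually_gt_nhds (by linarith : β / 2 < β))
      filter_upwards [hb] with p hp ι v S hS hcard
      obtain ⟨i, hi, Y, hY, hYc, hYe⟩ := hR (max s (t + 1)) hp.le hS.toIsCode
        (by exact_mod_cast hcard.le)
      obtain ⟨Y', hY', hY'c⟩ := Finset.exists_subset_card_eq
        (by rw [hYc]; exact le_max_left _ _ : s ≤ Y.card)
      refine ⟨i, Finset.mem_erase.2 ⟨?_, hi⟩, Y', hY'.trans hY, hY'c, hYe.mono hY'⟩
      rintro rfl
      have h1 := hS.free Y hY hYe
      rw [hYc] at h1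
      have h2 : max s (t + 1) < t + 1 := by exact_mod_cast h1
      exact absurd h2 (not_lt.2 (le_max_right _ _)))
  refine ⟨N * (s + 2 * (J.card * K)) + R (max s (t + 1)), by positivity, h.mono ?_⟩
  filter_upwards [eventually_ge_atTop 1] with n hn
  have h1 : (1 : ℝ) ≤ (n : ℝ) ^ m := one_le_pow₀ (by exact_mod_cast hn)
  rw [Finset.sum_const, nsmul_eq_mul]
  calc (N : ℝ) * (s + 2 * (J.card * (K * (n : ℝ) ^ m))) + R (max s (t + 1))
      ≤ N * (s * (n : ℝ) ^ m + 2 * (J.card * (K * (n : ℝ) ^ m))) +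
        R (max s (t + 1)) * (n : ℝ) ^ m := by
        gcongr
        · exact le_mul_of_one_le_right (by positivity) h1
        · exact le_mul_of_one_le_right (by positivity) h1
    _ = _ := by ring


/-! ### The inductive step and the induction -/

theorem SharpBound.succ [Fintype κ] {m : ℕ} (h : ∀ k ≤ m, 1 ≤ k → SharpBound κ k) :
    SharpBound κ (m + 1) := by
  intro j₀ J β α hJ hj₀ hβ hα hα1 hmin ε hε
  have hpoly : PolyBound κ m := SharpBound.polyBound h
  have hpoly' : PolyBound κ (m - 1) :=
    SharpBound.polyBound fun k hk => h k (hk.trans (Nat.sub_le _ _))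
  rcases (hα1 j₀ hj₀).1.eq_or_lt with h0 | h0
  · refine (SharpBound.of_min_eq_zero (h m le_rfl) (fun _ => hpoly') hJ hj₀ hβ hα hα1 h0.symm
      hε).mono (Eventually.of_forall fun n => le_of_eq ?_)
    rw [← h0]
    simp
  have hlt := (hα1 j₀ hj₀).2
  have hs : 0 < 1 - α j₀ := by linarith
  set C : ℝ := m.factorial * 2 ^ (m + 1) with hC
  have hC0 : 0 < C := by positivity
  -- The least natural number with α_{j₀} < N β; it is at most 1 + α_{j₀}/β, the factor in the
  -- theorem.
  set N := ⌊α j₀ / β⌋₊ + 1 with hN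
  have hN1 : (N : ℝ) ≤ 1 + α j₀ / β := by
    rw [hN]
    push_cast
    linarith [Nat.floor_le (by positivity : 0 ≤ α j₀ / β)]
  have hN2 : α j₀ < N * β := by
    rw [← div_lt_iff₀ hβ, hN]
    exact_mod_cast Nat.lt_floor_add_one _
  obtain ⟨A, hA1, hA2⟩ := exists_between hN2
  obtain ⟨s, hs0, hsN⟩ : ∃ s > 0, N * ((1 + s) * (C + s)) < N * C + ε / 2 := by
    have hc : Continuous fun s : ℝ => (N : ℝ) * ((1 + s) * (C + s)) := by fun_prop
    have h1 : ∀ᶠ s in 𝓝 (0 : ℝ), (N : ℝ) * ((1 + s) * (C + s)) < N * C + ε / 2 :=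
      (hc.tendsto' 0 (N * C) (by simp)).eventually (eventually_lt_nhds (by linarith))
    have h1' : ∀ᶠ s in 𝓝[>] (0 : ℝ), (N : ℝ) * ((1 + s) * (C + s)) < N * C + ε / 2 :=
      nhdsWithin_le_nhds h1
    obtain ⟨s, h2, h3⟩ := (h1'.and self_mem_nhdsWithin).exists
    exact ⟨s, h3, h2⟩
  have hcl : ∀ j ∈ J.erase j₀, ∃ K : ℝ, 0 ≤ K ∧
      EvBoundClique ⊤ j₀ J β α j₀ j (fun n => K * (n : ℝ) ^ m) := by
    intro j hj
    have hj' := Finset.mem_of_mem_erase hj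
    have hjlt : α j₀ < α j := lt_of_le_of_ne (hmin j hj') fun h =>
      Finset.ne_of_mem_erase hj (hα hj' hj₀ h.symm)
    -- The projection therefore makes the smallest value negative, leaving at most m values.
    have hρ : α j₀ < α j ^ 2 / α j₀ := by
      rw [lt_div_iff₀ h0]
      nlinarith
    obtain ⟨K, hK, hb⟩ := hpoly.proj j₀ J β α hβ hα (fun i hi => (hα1 i hi).2)
      (h0.le.trans hρ.le) (by
        have hsub : J.filter (fun i => α j ^ 2 / α j₀ ≤ α i) ⊆ J.erase j₀ := by
          intro i hi
          obtain ⟨hi, hi'⟩ := Finset.mem_filter.1 hi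
          refine Finset.mem_erase.2 ⟨?_, hi⟩
          rintro rfl; linarith
        refine (Finset.card_le_card hsub).trans ?_
        rw [Finset.card_erase_of_mem hj₀, hJ]; rfl)
    exact ⟨K, hK, hb.clique h0⟩
  -- Here ρ = α_{j₀}, so the smallest value becomes exactly 0 and the constant no longer depends on
  -- the negative range.
  have hcl₀ : EvBoundClique ⊤ j₀ J β α j₀ j₀ (fun n => (C + s) * (n : ℝ) ^ (m + 1)) := by
    refine EvBoundProj.clique h0 ?_
    rw [sq, mul_self_div_self]
    refine EvBound.proj hlt ?_
    refine SharpBound.of_min_eq_zero (h m le_rfl) (fun _ => hpoly') hJ hj₀ (by positivity)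
      (fun a ha b hb hab => hα ha hb (by
        simp only [div_left_inj' hs.ne'] at hab
        linarith))
      (fun i hi => ⟨div_nonneg (by linarith [hmin i hi]) hs.le, by
        rw [div_lt_one hs]
        linarith [(hα1 i hi).2]⟩) (by simp) hs0
  obtain ⟨K, hK, hKb⟩ : ∃ K : ℝ, 0 ≤ K ∧ ∀ j ∈ J.erase j₀,
      EvBoundClique ⊤ j₀ J β α j₀ j (fun n => K * (n : ℝ) ^ m) := by
    choose! K hK0 hK using hcl
    refine ⟨∑ j ∈ J.erase j₀, K j, Finset.sum_nonneg hK0, fun j hj =>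
      (hK j hj).mono (Eventually.of_forall fun n => ?_)⟩
    have := Finset.single_le_sum hK0 hj
    gcongr
  choose L hL0 hL using fun t : ℕ => exists_evBound_of_free hpoly hJ hj₀ t hβ hα hα1 hmin
  let F : κ → ℕ → ℝ := fun j n => if j = j₀ then (C + s) * (n : ℝ) ^ (m + 1) else K * (n : ℝ) ^ m
  obtain ⟨t, ht⟩ := exists_evBound_of_cliques (T := ⊤) (j₀ := j₀) (I := {j₀}) (by simpa using hj₀)
    hβ hα (fun j hj => (hα1 j hj).1) (A := A) (by simpa using hA1) hA2
    (θ := 1 + s) (by linarith) (F := F)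
    (fun j n => by
      simp only [F]
      split_ifs <;> positivity)
    (by
      intro i hi j hj
      rw [Finset.mem_singleton] at hi
      subst hi
      by_cases hjj : j = i
      · subst hjj
        simpa [F] using hcl₀
      · have hFj : F j = fun n : ℕ => K * (n : ℝ) ^ m := by
          funext n
          exact if_neg hjj
        rw [hFj]
        exact hKb j (Finset.mem_erase.2 ⟨hjj, hj⟩))
    -- A code larger than this cannot be free of cliques of size `t` in colour `j₀`.
    (R := fun t n => L t * (n : ℝ) ^ m) (by
      intro t
      filter_upwards [hL t] with p hp ι v S hS hcard
      by_contra hcon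
      push Not at hcon
      refine absurd (hp ι v S ⟨hS.toIsCode, fun Y hY hYe => ?_⟩) (not_le.2 hcard)
      by_contra hle
      have hle' : t ≤ Y.card := by exact_mod_cast not_lt.1 hle
      obtain ⟨Y', hY', hY'c⟩ := Finset.exists_subset_card_eq hle'
      exact hcon j₀ (by simp) Y' (hY'.trans hY) hY'c (hYe.mono hY'))
  refine ht.mono ?_
  have hsumF : ∀ n, ∑ j ∈ J, F j n = (C + s) * (n : ℝ) ^ (m + 1) + m * (K * (n : ℝ) ^ m) := by
    intro n
    rw [← Finset.add_sum_erase _ _ hj₀]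
    have h1 : ∀ j ∈ J.erase j₀, F j n = K * (n : ℝ) ^ m := fun j hj =>
      if_neg (Finset.ne_of_mem_erase hj)
    rw [Finset.sum_congr rfl h1, Finset.sum_const, nsmul_eq_mul, Finset.card_erase_of_mem hj₀, hJ,
      Nat.add_sub_cancel]
    simp [F]
  filter_upwards [eventually_ge_atTop 1, eventually_mul_pow_le
    (K := N * (t + (1 + s) * (m * K)) + L t) (by positivity : 0 < ε / 2) m] with n hn hn2
  rw [hsumF]
  have h1 : (1 : ℝ) ≤ (n : ℝ) ^ m := one_le_pow₀ (by exact_mod_cast hn)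
  calc (N : ℝ) * (t + (1 + s) * ((C + s) * (n : ℝ) ^ (m + 1) + m * (K * (n : ℝ) ^ m))) +
        L t * (n : ℝ) ^ m
      ≤ (N : ℝ) * (t * (n : ℝ) ^ m +
          (1 + s) * ((C + s) * (n : ℝ) ^ (m + 1) + m * (K * (n : ℝ) ^ m))) +
        L t * (n : ℝ) ^ m := by
        gcongr
        exact le_mul_of_one_le_right (by positivity) h1
    _ = (N * ((1 + s) * (C + s))) * (n : ℝ) ^ (m + 1) +
        (N * (t + (1 + s) * (m * K)) + L t) * (n : ℝ) ^ m := by ring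
    _ ≤ (N * C + ε / 2) * (n : ℝ) ^ (m + 1) + ε / 2 * (n : ℝ) ^ (m + 1) := by gcongr
    _ = (N * C + ε) * (n : ℝ) ^ (m + 1) := by ring
    _ ≤ ((1 + α j₀ / β) * C + ε) * (n : ℝ) ^ (m + 1) := by gcongr
    _ = _ := by
        rw [hC, Nat.add_sub_cancel]
        ring

theorem sharpBound (κ : Type) [Fintype κ] (k : ℕ) (hk : 1 ≤ k) : SharpBound κ k := by
  induction k using Nat.strong_induction_on with
  | _ k ih =>
    obtain ⟨m, rfl⟩ : ∃ m, k = m + 1 := ⟨k - 1, by omega⟩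
    exact SharpBound.succ fun k' hk' => ih k' (by omega)

end SphericalCode

/-! ### The theorem for spherical codes -/

theorem mainTheorem3 (k : ℕ) (hk : 0 < k) (β : ℝ) (hβ : β ∈ Set.Ioc (0 : ℝ) 1)
    (α : Fin k → ℝ) (hα : ∀ i, α i ∈ Set.Ico (0 : ℝ) 1) (hmono : StrictMono α)
    (δ : ℕ → ℝ) (hδ : Tendsto δ atTop (𝓝 0))
    (η : Fin k → ℕ → ℝ) (hη : ∀ i, Tendsto (η i) atTop (𝓝 0)) :
    ∃ r : ℕ → ℝ, r =o[atTop] (fun n : ℕ => (n : ℝ) ^ k) ∧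
      ∀ᶠ n : ℕ in atTop, ∀ C : Finset (EuclideanSpace ℝ (Fin n)),
        IsSphericalCode
            (Set.Icc (-1 : ℝ) (-β + δ n) ∪ Set.range (fun i : Fin k => α i + η i n)) C →
          (C.card : ℝ) ≤
            (1 + α ⟨0, hk⟩ / β) * ((k - 1).factorial : ℝ) * (2 * (n : ℝ)) ^ k + r n := by
  set j₀ : Fin k := ⟨0, hk⟩ with hj₀
  set M : ℕ → ℝ := fun n => (1 + α j₀ / β) * ((k - 1).factorial : ℝ) * (2 * (n : ℝ)) ^ k with hM
  let L : ℕ → Set ℝ := fun n =>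
    Set.Icc (-1 : ℝ) (-β + δ n) ∪ Set.range (fun i : Fin k => α i + η i n)
  have hbound : ∀ ε > 0, ∀ᶠ n : ℕ in atTop, ∀ C : Finset (EuclideanSpace ℝ (Fin n)),
      IsSphericalCode (L n) C → (C.card : ℝ) - M n ≤ ε * (n : ℝ) ^ k := by
    intro ε hε
    have h1 := SphericalCode.sharpBound (Fin k) k hk j₀ Finset.univ β α (by simp)
      (Finset.mem_univ _) hβ.1 hmono.injective.injOn (fun j _ => hα j)
      (fun j _ => hmono.monotone (Fin.mk_le_of_le_val (Nat.zero_le _))) ε hε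
    have ht : Tendsto (fun n : ℕ => (n, β - δ n, fun i => α i + η i n)) atTop
        (atTop ×ˢ 𝓝 (β, α)) := by
      refine tendsto_id.prodMk (Tendsto.prodMk_nhds ?_ (tendsto_pi_nhds.2 fun i => ?_))
      · simpa using hδ.const_sub β
      · simpa using (hη i).const_add (α i)
    filter_upwards [ht.eventually h1] with n hn C hC
    obtain ⟨-, hunit, hpair⟩ := hC
    have h2 := hn (EuclideanSpace ℝ (Fin n)) id C (SphericalCode.IsCode.free_top
      ⟨fun x hx => by simp [hunit x hx], fun x hx y hy hne => by
        rcases hpair x hx y hy hne with h | ⟨i, hi⟩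
        · left
          have := h.2
          simp only [id]
          linarith
        · exact Or.inr ⟨i, Finset.mem_univ _, hi.symm⟩⟩ j₀)
    have h3 : M n = (1 + α j₀ / β) * (k - 1).factorial * 2 ^ k * (n : ℝ) ^ k := by
      simp only [hM, mul_pow]
      ring
    rw [h3]
    linarith
  -- The remainder r(n) is the supremum of the excess over all codes in dimension n. Including 0
  -- makes it nonnegative; boundedness for large n comes from the bound with ε = 1, and the bounds
  -- for all ε give o(n^k).
  let V : ℕ → Set ℝ := fun n =>
    insert 0 {x | ∃ C : Finset (EuclideanSpace ℝ (Fin n)), IsSphericalCode (L n) C ∧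
      x = C.card - M n}
  have hV : ∀ n ε, 0 ≤ ε → (∀ C : Finset (EuclideanSpace ℝ (Fin n)),
      IsSphericalCode (L n) C → (C.card : ℝ) - M n ≤ ε * (n : ℝ) ^ k) →
      ε * (n : ℝ) ^ k ∈ upperBounds (V n) := by
    rintro n ε hε h x (rfl | ⟨C, hC, rfl⟩)
    · positivity
    · exact h C hC
  refine ⟨fun n => sSup (V n), ?_, ?_⟩
  · rw [isLittleO_iff]
    intro ε hε
    filter_upwards [hbound ε hε] with n hn
    have h1 := hV n ε hε.le hn
    have h2 : 0 ≤ sSup (V n) := le_csSup ⟨_, h1⟩ (Set.mem_insert _ _)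
    rw [Real.norm_of_nonneg h2, Real.norm_of_nonneg (by positivity)]
    exact csSup_le ⟨0, Set.mem_insert _ _⟩ h1
  · filter_upwards [hbound 1 one_pos] with n hn C hC
    have h1 := le_csSup ⟨_, hV n 1 zero_le_one hn⟩ (Set.mem_insert_of_mem 0 ⟨C, hC, rfl⟩)
    linarith
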